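/- Let $\lambda\in\mathbb C$, $r>0$, $\Delta=\{x\in\mathbb C: |x|<r\}$ and $\Delta^*=\Delta\setminus\{0\}$, identified with subsets of the line $y=0$ in $\mathbb C^2$. For $i=1,2$ let $f_i$ be a holomorphic function on a neighbourhood of $\Delta\times\{0\}$ with $f_i(x,0)=0$ for all $x\in\Delta$, and let $$\mathcal F_i=\ker\omega_i,\qquad \omega_i=x\,dy-(\lambda+f_i(x,y))\,y\,dx .$$ Holonomy. Fix $x_0\in\Delta^*$ and put $p=(x_0,0)$. A minimal first integral of $\mathcal F_i$ at $p$ is a germ $H$ of holomorphic function at $p$ with $H(p)=0$, $dH(p)\neq0$ and $\ker dH=\ker\omega_i$ near $p$. If its analytic continuation along the loop $\gamma(t)=(x_0e^{2i\pi t},0)$, $t\in[0,1]$, ends with the germ $\varphi\circ H$, $\varphi\in\mathrm{Diff}(\mathbb C,0)$, then $\varphi$ is called a representative of the holonomy of $\mathcal F_i$ along $\Delta^*$; it is called a normalized representative if $H(x_0,y)=y+o(y)$. A formal series $\psi\in\mathbb C[[z]]$ with $\psi(0)=0$, $\psi'(0)\ne0$ is a formal conjugacy between $\varphi_1,\varphi_2\in\mathrm{Diff}(\mathbb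 C,0)$ if $\psi\circ\varphi_1=\varphi_2\circ\psi$; the germs are formally conjugated if such a $\psi$ exists. For $c\in\mathbb C^*$, a transversely formal diffeomorphism $\hat\Phi(x,y)=(x,cy+o(y))$ along $\Delta$ is given by a power series $cy+\sum_{n\ge2}a_n(x)y^n$ with all $a_n$ holomorphic on $\Delta$ (no convergence in $y$ is required). It conjugates the foliations if $\hat\Phi^*\omega_2\wedge\omega_1=0$. Then normalized representatives of the holonomies of $\mathcal F_1$ and $\mathcal F_2$ along $\Delta^*$ exist, and: 1. for any normalized representatives $\varphi_1,\varphi_2$ of these holonomies, there is a transversely formal diffeomorphism $\hat\Phi(x,y)=(x,y+o(y))$ along $\Delta$ conjugating $\mathcal F_1$ and $\mathcal F_2$ if and only if $\varphi_1$ and $\varphi_2$ are conjugated by a formal series tangent to the identity, $\psi(z)=z+o(z)$; 2. for any representatives $\varphi_1,\varphi_2$ of these holonomies, there are $c\in\mathbb C^*$ and a transversely formal diffeomorphism $\hat\Phi(x,y)=(x,cy+o(y))$ along $\Delta$ conjugating $\mathcal F_1$ and $\mathcal F_2$ if and only if $\varphi_1$ and $\varphi_2$ are formally conjugated. -/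

import Mathlib

open Filter Topology PowerSeries

noncomputable section

/-- The disc `|x| < r`, identified with the subset `y = 0` of `ℂ × ℂ` below. -/
abbrev disc (r : ℝ) : Set ℂ := Metric.ball 0 r

/-- The `1`-form `ω = x dy - (lam + f(x,y)) y dx` on `ℂ × ℂ`; the foliation is its kernel. -/
def foliationForm (lam : ℂ) (f : ℂ × ℂ → ℂ) (q : ℂ × ℂ) : ℂ × ℂ →L[ℂ] ℂ :=
  q.1 • ContinuousLinearMap.snd ℂ ℂ ℂ - ((lam + f q) * q.2) • ContinuousLinearMap.fst ℂ ℂ ℂ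

/-- `f` is analytic on a neighbourhood of the disc `{(x,0) : |x| < r}` and vanishes on it, so that
`x dy - (lam + f) y dx` is of the form `x dy - (lam + o(1)) y dx` as `y → 0`. -/
def IsPerturbation (r : ℝ) (f : ℂ × ℂ → ℂ) : Prop :=
  AnalyticOnNhd ℂ f (disc r ×ˢ {0}) ∧ ∀ x ∈ disc r, f (x, 0) = 0

/-! ### Holonomy along the punctured disc -/

/-- `H` is (a representative of the germ of) a minimal first integral at `p`, with `H p = 0`:
it is analytic, `dH` does not vanish at `p`, and near `p` the kernel of `dH` is that of `ω`. -/
def IsMinimalFirstIntegral (ω : ℂ × ℂ → (ℂ × ℂ →L[ℂ] ℂ)) (p : ℂ × ℂ) (H : ℂ × ℂ → ℂ) : Prop :=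
  AnalyticAt ℂ H p ∧ H p = 0 ∧ fderiv ℂ H p ≠ 0 ∧
    ∀ᶠ q in 𝓝 p, ∀ v, fderiv ℂ H q v = 0 ↔ ω q v = 0

/-- The loop `t ↦ (x₀ exp(2 i π t), 0)`, for `t ∈ [0,1]`. -/
def loop (x₀ : ℂ) (t : ℝ) : ℂ × ℂ :=
  (x₀ * Complex.exp (2 * Real.pi * Complex.I * t), 0)

/-- `(K t)`, `t ∈ [0,1]`, is an analytic continuation along the path `γ`: `K t` is a germ of
analytic function at `γ t`, and for `s` close to `t` the germ `K s` is the germ of `K t` at `γ s`. -/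
def IsAnalyticContinuation (γ : ℝ → ℂ × ℂ) (K : ℝ → ℂ × ℂ → ℂ) : Prop :=
  ∀ t ∈ Set.Icc (0 : ℝ) 1, AnalyticAt ℂ (K t) (γ t) ∧
    ∀ᶠ s in 𝓝[Set.Icc (0 : ℝ) 1] t, K s =ᶠ[𝓝 (γ s)] K t

/-- `φ` represents an element of `Diff(ℂ,0)`. -/
def IsDiffGerm (φ : ℂ → ℂ) : Prop :=
  AnalyticAt ℂ φ 0 ∧ φ 0 = 0 ∧ deriv φ 0 ≠ 0

/-- `φ ∈ Diff(ℂ,0)` is the monodromy of `H` along the loop: the analytic continuation of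
`H` along the loop ends with the germ `φ ∘ H`. -/
def IsMonodromy (x₀ : ℂ) (H : ℂ × ℂ → ℂ) (φ : ℂ → ℂ) : Prop :=
  IsDiffGerm φ ∧ ∃ K : ℝ → ℂ × ℂ → ℂ, IsAnalyticContinuation (loop x₀) K ∧
    K 0 =ᶠ[𝓝 (x₀, 0)] H ∧ K 1 =ᶠ[𝓝 (x₀, 0)] φ ∘ H

/-- `φ` is a representative of the holonomy of `ker ω` along the punctured disc (based at
`(x₀,0)`): the monodromy of some minimal first integral. -/
def IsHolonomy (ω : ℂ × ℂ → (ℂ × ℂ →L[ℂ] ℂ)) (x₀ : ℂ) (φ : ℂ → ℂ) : Prop :=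
  ∃ H, IsMinimalFirstIntegral ω (x₀, 0) H ∧ IsMonodromy x₀ H φ

/-- `φ` is a normalized representative of the holonomy: the monodromy of a minimal first integral
`H` with `H(x₀,y) = y + o(y)`. -/
def IsNormalizedHolonomy (ω : ℂ × ℂ → (ℂ × ℂ →L[ℂ] ℂ)) (x₀ : ℂ) (φ : ℂ → ℂ) : Prop :=
  ∃ H, IsMinimalFirstIntegral ω (x₀, 0) H ∧ fderiv ℂ H (x₀, 0) (0, 1) = 1 ∧ IsMonodromy x₀ H φ

/-! ### Formal conjugacy of germs -/

/-- The Taylor series at `0` of a function of one variable. -/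
def taylorAtZero (φ : ℂ → ℂ) : ℂ⟦X⟧ :=
  PowerSeries.mk fun n => iteratedDeriv n φ 0 / (n.factorial : ℂ)

/-- `A ∘ B`, for formal power series with `B(0) = 0`. -/
def formalComp (A B : ℂ⟦X⟧) : ℂ⟦X⟧ := PowerSeries.subst B A

/-- The formal series `ψ` satisfies `ψ ∘ φ₁ = φ₂ ∘ ψ` and `ψ(z) = c z + o(z)`. -/
def IsFormalConjugacy (c : ℂ) (ψ : ℂ⟦X⟧) (φ₁ φ₂ : ℂ → ℂ) : Prop :=
  coeff 0 ψ = 0 ∧ coeff 1 ψ = c ∧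
    formalComp ψ (taylorAtZero φ₁) = formalComp (taylorAtZero φ₂) ψ

/-- `φ₁` and `φ₂` are conjugated by a formal diffeomorphism. -/
def FormallyConjugate (φ₁ φ₂ : ℂ → ℂ) : Prop :=
  ∃ c : ℂ, c ≠ 0 ∧ ∃ ψ : ℂ⟦X⟧, IsFormalConjugacy c ψ φ₁ φ₂

/-- `φ₁` and `φ₂` are conjugated by a formal diffeomorphism tangent to the identity. -/
def TangentFormallyConjugate (φ₁ φ₂ : ℂ → ℂ) : Prop :=
  ∃ ψ : ℂ⟦X⟧, IsFormalConjugacy 1 ψ φ₁ φ₂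

/-! ### Transversely formal objects

A power series `∑ aₙ(x) yⁿ` whose coefficients are functions on `D ⊆ ℂ` is given by the function
`x ↦ ∑ aₙ(x) yⁿ` with values in `ℂ⟦X⟧` (the variable `y` is `X`); only its values for
`x ∈ D` matter. -/

/-- `F` is an element of `𝒪(D)[[y]]`. -/
def IsTransverselyFormal (D : Set ℂ) (F : ℂ → ℂ⟦X⟧) : Prop :=
  ∀ n, AnalyticOnNhd ℂ (fun x => coeff n (F x)) D

/-- The derivative with respect to `x`, coefficient by coefficient. -/
def dX (F : ℂ → ℂ⟦X⟧) (x : ℂ) : ℂ⟦X⟧ := PowerSeries.mk fun n => deriv (fun t => coeff n (F t)) x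

/-- The derivative with respect to `y`. -/
def dY (F : ℂ → ℂ⟦X⟧) (x : ℂ) : ℂ⟦X⟧ := PowerSeries.derivative ℂ (F x)

/-- A transversely formal `1`-form `A dx + B dy`. -/
structure FormalForm where
  A : ℂ → ℂ⟦X⟧
  B : ℂ → ℂ⟦X⟧

/-- The expansion in powers of `y` of a `1`-form that is analytic near the line `y = 0`. -/
def transverseExpansion (ω : ℂ × ℂ → (ℂ × ℂ →L[ℂ] ℂ)) : FormalForm where
  A x := taylorAtZero fun y => ω (x, y) (1, 0)
  B x := taylorAtZero fun y => ω (x, y) (0, 1)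

/-- The pull-back `Φ^*(A dx + B dy) = (A∘Φ) dx + (B∘Φ) dY` under `Φ(x,y) = (x, Y(x,y))`. -/
def FormalForm.pullback (Y : ℂ → ℂ⟦X⟧) (α : FormalForm) : FormalForm where
  A x := formalComp (α.A x) (Y x) + formalComp (α.B x) (Y x) * dX Y x
  B x := formalComp (α.B x) (Y x) * dY Y x

/-- The coefficient of `dx ∧ dy` in `α ∧ β`. -/
def FormalForm.wedge (α β : FormalForm) (x : ℂ) : ℂ⟦X⟧ := α.A x * β.B x - α.B x * β.A x

/-- `Φ(x,y) = (x, Y(x,y))` is a transversely formal diffeomorphism along `D` of the form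
`(x, c y + o(y))` (where `c ≠ 0`). -/
def IsFiberedFormalDiffeo (D : Set ℂ) (c : ℂ) (Y : ℂ → ℂ⟦X⟧) : Prop :=
  IsTransverselyFormal D Y ∧ ∀ x ∈ D, coeff 0 (Y x) = 0 ∧ coeff 1 (Y x) = c

/-- Some `Φ(x,y) = (x, c y + o(y))`, transversely formal along `D`, satisfies `Φ^*ω₂ ∧ ω₁ = 0`. -/
def FormalFoliationConjugacy (D : Set ℂ) (c : ℂ) (ω₁ ω₂ : ℂ × ℂ → (ℂ × ℂ →L[ℂ] ℂ)) : Prop :=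
  ∃ Y : ℂ → ℂ⟦X⟧, IsFiberedFormalDiffeo D c Y ∧
    ∀ x ∈ D, ((transverseExpansion ω₂).pullback Y).wedge (transverseExpansion ω₁) x = 0

end

/-!
# Formal conjugacy of foliations and of their holonomies

Write the foliation `x dy - (lam + f) y dx = 0` as `x dy/dx = G(x, y)`, `G = lam y + o(y)`
(`leafSlope`). A first integral `H = h₁(x) y + ⋯` satisfies the transport equation
`x ∂ₓH + G ∂_yH = 0`, which is triangular for the coefficients of the powers of `y`, and a
transversely formal map `y ↦ Y(x, y)` conjugates the two foliations exactly when
`x ∂ₓY + G₁ ∂_yY = G₂ ∘ Y` (`wedge_eq_zero_iff`). Everything is expanded in powers of `y` and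
followed along the loop: a first integral `H` with monodromy `φ` becomes a path `h t` of formal
series that solves the transport equation and satisfies `h 1 = φ ∘ h 0`
(`exists_formalFirstIntegral`).

*From foliations to holonomies* (`conjugacy_of_foliationConjugacy`). If `Y` is a conjugacy then
`h₂ ∘ Y` is a first integral of the first foliation. By uniqueness for the transport equation it is
`ψ ∘ h₁` for a constant series `ψ`, and comparing both ends of the loop gives
`ψ ∘ φ₁ = φ₂ ∘ ψ`.

*From holonomies to foliations*. The coefficient of degree `n` of the conjugacy equation is an Euler
equation `x a' + (n - 1) lam a = P`, where `P` is holomorphic on the disc and depends only on the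
lower coefficients. There are two cases.

* If `k + (n - 1) lam ≠ 0` for all `n ≥ 2`, `k ≥ 0`, each of these equations has a holomorphic
  solution on the disc, found by dividing Taylor coefficients by `k + (n - 1) lam`. The foliations
  are then conjugate, without any assumption on the holonomies
  (`foliationConjugacy_of_not_resonant`).
* Otherwise `lam` is a nonpositive rational number. The series `h₂⁻¹ ∘ ψ ∘ h₁` solves the conjugacy
  equation along the loop, and it is periodic because `ψ` conjugates the holonomies
  (`exists_conjugacy_along_loop`). Periodicity makes the resonant Taylor coefficient of `P` vanish,
  so that a holomorphic solution exists; it can be chosen to extend the one given along the loop,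
  as `(n - 1) lam` is not a positive integer (`exists_euler_solution_extending`).

*Existence of holonomies* (`exists_normalizedHolonomy`). In the coordinate `s = log (x / x₀)` the
transport equation is solved coefficient by coefficient on a convex neighbourhood of `[0, 2iπ]`,
with initial value `y`. A majorant shows that the coefficients grow at most geometrically
(`exists_triangular_solution`), so that the series converges to an analytic function, which is
continued along the loop by following the branches of the logarithm.
-/

/-! ### Composition of formal power series -/

theorem hasSubst_of_coeff_zero {B : ℂ⟦X⟧} (hB : coeff 0 B = 0) : HasSubst B :=
  HasSubst.of_constantCoeff_zero' (by simpa using hB)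

theorem coeff_pow_eq_zero_of_lt {B : ℂ⟦X⟧} (hB : coeff 0 B = 0) {n j : ℕ} (h : n < j) :
    coeff n (B ^ j) = 0 := by
  have h1 : (X : ℂ⟦X⟧) ∣ B := X_dvd_iff.2 (by simpa using hB)
  exact X_pow_dvd_iff.1 (pow_dvd_pow_of_dvd h1 j) n h

/-- The coefficients of a composite series are finite sums, which may be truncated at any
order above the degree of the coefficient. -/
theorem coeff_formalComp {A B : ℂ⟦X⟧} (hB : coeff 0 B = 0) {n N : ℕ} (h : n < N) :
    coeff n (formalComp A B) = ∑ j ∈ Finset.range N, coeff j A * coeff n (B ^ j) := by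
  rw [formalComp, coeff_subst' (hasSubst_of_coeff_zero hB),
    finsum_eq_sum_of_support_subset (s := Finset.range N)]
  · simp
  · intro j hj
    by_contra hj'
    apply hj
    have : n < j := by
      have : N ≤ j := by simpa using hj'
      omega
    simp [coeff_pow_eq_zero_of_lt hB this]

theorem formalComp_mul (A A' : ℂ⟦X⟧) {B : ℂ⟦X⟧} (hB : coeff 0 B = 0) :
    formalComp (A * A') B = formalComp A B * formalComp A' B :=
  subst_mul (hasSubst_of_coeff_zero hB) _ _

theorem formalComp_add (A A' : ℂ⟦X⟧) {B : ℂ⟦X⟧} (hB : coeff 0 B = 0) :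
    formalComp (A + A') B = formalComp A B + formalComp A' B :=
  subst_add (hasSubst_of_coeff_zero hB) _ _

theorem formalComp_C (a : ℂ) (B : ℂ⟦X⟧) : formalComp (C a) B = C a := subst_C _

theorem formalComp_X {B : ℂ⟦X⟧} (hB : coeff 0 B = 0) : formalComp X B = B :=
  subst_X (hasSubst_of_coeff_zero hB)

theorem formalComp_X_right (A : ℂ⟦X⟧) : formalComp A X = A := X_subst A

theorem formalComp_C_mul (a : ℂ) (A : ℂ⟦X⟧) {B : ℂ⟦X⟧} (hB : coeff 0 B = 0) :
    formalComp (C a * A) B = C a * formalComp A B := by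
  rw [formalComp_mul _ _ hB, formalComp_C]

theorem formalComp_neg (A : ℂ⟦X⟧) {B : ℂ⟦X⟧} (hB : coeff 0 B = 0) :
    formalComp (-A) B = -formalComp A B := by
  have h := formalComp_C_mul (-1) A hB
  have h1 : (C (-1 : ℂ) : ℂ⟦X⟧) = -1 := by rw [map_neg, map_one]
  rwa [h1, neg_one_mul, neg_one_mul] at h

theorem coeff_zero_formalComp {A B : ℂ⟦X⟧} (hA : coeff 0 A = 0) (hB : coeff 0 B = 0) :
    coeff 0 (formalComp A B) = 0 := by
  rw [coeff_formalComp hB zero_lt_one, Finset.sum_range_one, hA, zero_mul]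

theorem coeff_one_formalComp {A B : ℂ⟦X⟧} (hB : coeff 0 B = 0) :
    coeff 1 (formalComp A B) = coeff 1 A * coeff 1 B := by
  rw [coeff_formalComp hB (show 1 < 2 by norm_num)]; simp [Finset.sum_range_succ, coeff_one]

theorem formalComp_assoc (A : ℂ⟦X⟧) {B D : ℂ⟦X⟧} (hB : coeff 0 B = 0) (hD : coeff 0 D = 0) :
    formalComp (formalComp A B) D = formalComp A (formalComp B D) :=
  subst_comp_subst_apply (hasSubst_of_coeff_zero hB) (hasSubst_of_coeff_zero hD) A

theorem derivative_formalComp (A : ℂ⟦X⟧) {B : ℂ⟦X⟧} (hB : coeff 0 B = 0) :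
    derivative ℂ (formalComp A B) = formalComp (derivative ℂ A) B * derivative ℂ B :=
  derivative_subst (hasSubst_of_coeff_zero hB)

theorem exists_formal_inverse {A : ℂ⟦X⟧} (hA : coeff 0 A = 0) (hA' : coeff 1 A ≠ 0) :
    ∃ L : ℂ⟦X⟧, coeff 0 L = 0 ∧ formalComp A L = X ∧ formalComp L A = X := by
  have h0 : A.constantCoeff = 0 := by simpa using hA
  refine ⟨A.substInvOfIsUnit hA'.isUnit, ?_, ?_, ?_⟩
  · simp
  · exact subst_substInvOfIsUnit_right A h0 hA'.isUnit
  · exact subst_substInvOfIsUnit_left A h0 hA'.isUnit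

theorem formalComp_left_cancel {A B B' : ℂ⟦X⟧} (hA : coeff 0 A = 0) (hA' : coeff 1 A ≠ 0)
    (hB : coeff 0 B = 0) (hB' : coeff 0 B' = 0) (h : formalComp A B = formalComp A B') :
    B = B' := by
  obtain ⟨L, hL, -, hLA⟩ := exists_formal_inverse hA hA'
  have := congrArg (formalComp L) h
  rwa [← formalComp_assoc _ hA hB, ← formalComp_assoc _ hA hB', hLA, formalComp_X hB,
    formalComp_X hB'] at this

theorem formalComp_right_cancel {A B B' : ℂ⟦X⟧} (hA : coeff 0 A = 0) (hA' : coeff 1 A ≠ 0)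
    (h : formalComp B A = formalComp B' A) : B = B' := by
  obtain ⟨L, hL, hAL, -⟩ := exists_formal_inverse hA hA'
  have := congrArg (fun Z => formalComp Z L) h
  simpa only [formalComp_assoc _ hA hL, hAL, formalComp_X_right] using this

theorem formalComp_derivative_ne_zero {A B : ℂ⟦X⟧} (hA : coeff 1 A ≠ 0) (hB : coeff 0 B = 0) :
    formalComp (derivative ℂ A) B ≠ 0 := by
  intro h
  have := congrArg (coeff 0) h
  rw [coeff_formalComp hB zero_lt_one] at this
  simp [coeff_derivative, hA] at this

/-! ### Dependence of nonlinear terms on lower coefficients -/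

theorem coeff_pow_congr {B B' : ℂ⟦X⟧} (hB : coeff 0 B = 0) (hB' : coeff 0 B' = 0) {n j : ℕ}
    (h : ∀ k < n, coeff k B = coeff k B') (hj : 2 ≤ j) : coeff n (B ^ j) = coeff n (B' ^ j) := by
  have h1 : (X : ℂ⟦X⟧) ∣ B := X_dvd_iff.2 (by simpa using hB)
  have h2 : (X : ℂ⟦X⟧) ∣ B' := X_dvd_iff.2 (by simpa using hB')
  have h3 : (X : ℂ⟦X⟧) ^ n ∣ B - B' := X_pow_dvd_iff.2 fun k hk => by simp [h k hk]
  have h4 : (X : ℂ⟦X⟧) ∣ ∑ i ∈ Finset.range j, B ^ i * B' ^ (j - 1 - i) := by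
    refine Finset.dvd_sum fun i hi => ?_
    rcases Nat.eq_zero_or_pos i with rfl | hi0
    · exact Dvd.dvd.mul_left (dvd_pow h2 (by omega)) _
    · exact Dvd.dvd.mul_right (dvd_pow h1 (by omega)) _
  have h5 : (X : ℂ⟦X⟧) ^ (n + 1) ∣ B ^ j - B' ^ j := by
    rw [← (Commute.all B B').geom_sum₂_mul, pow_succ', ]
    exact mul_dvd_mul h4 h3
  have := X_pow_dvd_iff.1 h5 n (Nat.lt_succ_self n)
  rwa [map_sub, sub_eq_zero] at this

theorem coeff_formalComp_congr {R B B' : ℂ⟦X⟧} (hR : coeff 1 R = 0) (hB : coeff 0 B = 0)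
    (hB' : coeff 0 B' = 0) {n : ℕ} (h : ∀ k < n, coeff k B = coeff k B') :
    coeff n (formalComp R B) = coeff n (formalComp R B') := by
  rw [coeff_formalComp hB (Nat.lt_succ_self n), coeff_formalComp hB' (Nat.lt_succ_self n)]
  refine Finset.sum_congr rfl fun j _ => ?_
  match j with
  | 0 => simp
  | 1 => simp [hR]
  | j + 2 => rw [coeff_pow_congr hB hB' h (by omega)]

theorem coeff_mul_derivative_congr {R B B' : ℂ⟦X⟧} (hR0 : coeff 0 R = 0) (hR : coeff 1 R = 0)
    {n : ℕ} (h : ∀ k < n, coeff k B = coeff k B') :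
    coeff n (R * derivative ℂ B) = coeff n (R * derivative ℂ B') := by
  rw [coeff_mul, coeff_mul]
  refine Finset.sum_congr rfl fun p hp => ?_
  have hp' := Finset.HasAntidiagonal.mem_antidiagonal.1 hp
  match hp1 : p.1 with
  | 0 => simp [hR0]
  | 1 => simp [hR]
  | j + 2 => rw [coeff_derivative, coeff_derivative, h _ (by omega)]

/-! ### Coefficientwise differentiation along a path -/

/-- `t ↦ u t` is differentiable within `[0,1]` at `t`, coefficient by coefficient, with
derivative `u'`. -/
def HasCoeffDeriv (u : ℝ → ℂ⟦X⟧) (u' : ℂ⟦X⟧) (t : ℝ) : Prop :=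
  ∀ n, HasDerivWithinAt (fun s => coeff n (u s)) (coeff n u') (Set.Icc 0 1) t

theorem hasCoeffDeriv_const (A : ℂ⟦X⟧) (t : ℝ) : HasCoeffDeriv (fun _ => A) 0 t := fun n => by
  simpa using hasDerivWithinAt_const t (Set.Icc 0 1) (coeff n A)

theorem HasCoeffDeriv.sub {u v : ℝ → ℂ⟦X⟧} {u' v' : ℂ⟦X⟧} {t : ℝ} (hu : HasCoeffDeriv u u' t)
    (hv : HasCoeffDeriv v v' t) : HasCoeffDeriv (fun s => u s - v s) (u' - v') t := fun n => by
  simpa using! (hu n).sub (hv n)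

theorem HasCoeffDeriv.mul {u v : ℝ → ℂ⟦X⟧} {u' v' : ℂ⟦X⟧} {t : ℝ} (hu : HasCoeffDeriv u u' t)
    (hv : HasCoeffDeriv v v' t) : HasCoeffDeriv (fun s => u s * v s) (u' * v t + u t * v') t := by
  intro n
  simp only [coeff_mul, map_add, ← Finset.sum_add_distrib]
  exact HasDerivWithinAt.fun_sum fun p _ => (hu p.1).mul (hv p.2)

theorem HasCoeffDeriv.pow {u : ℝ → ℂ⟦X⟧} {u' : ℂ⟦X⟧} {t : ℝ} (hu : HasCoeffDeriv u u' t) (j : ℕ) :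
    HasCoeffDeriv (fun s => u s ^ j) (j * u t ^ (j - 1) * u') t := by
  induction j with
  | zero => simpa using hasCoeffDeriv_const 1 t
  | succ j ih =>
    have h := ih.mul hu
    simp only [← pow_succ] at h
    convert h using 1
    rcases j with _ | j
    · simp
    · simp only [Nat.add_sub_cancel]; push_cast; ring

theorem HasCoeffDeriv.unique {u : ℝ → ℂ⟦X⟧} {u' u'' : ℂ⟦X⟧} {t : ℝ} (ht : t ∈ Set.Icc (0 : ℝ) 1)
    (h : HasCoeffDeriv u u' t) (h' : HasCoeffDeriv u u'' t) : u' = u'' := by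
  ext n
  exact (uniqueDiffOn_Icc zero_lt_one t ht).eq_deriv _ (h n) (h' n)

/-- The chain rule for a family of composite formal series. -/
theorem HasCoeffDeriv.formalComp {a b : ℝ → ℂ⟦X⟧} {a' b' : ℂ⟦X⟧} {t : ℝ}
    (ht : t ∈ Set.Icc (0 : ℝ) 1) (hb0 : ∀ s ∈ Set.Icc (0 : ℝ) 1, coeff 0 (b s) = 0)
    (ha : HasCoeffDeriv a a' t) (hb : HasCoeffDeriv b b' t) :
    HasCoeffDeriv (fun s => formalComp (a s) (b s))
      (formalComp a' (b t) + formalComp (derivative ℂ (a t)) (b t) * b') t := by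
  intro n
  have hn : n < n + 2 := by omega
  refine HasDerivWithinAt.congr_of_mem
    (f := fun s => ∑ j ∈ Finset.range (n + 2), coeff j (a s) * coeff n (b s ^ j)) ?_
    (fun s hs => coeff_formalComp (hb0 s hs) hn) ht
  rw [map_add, coeff_formalComp (hb0 t ht) hn]
  have key : coeff n (_root_.formalComp (derivative ℂ (a t)) (b t) * b') =
      ∑ j ∈ Finset.range (n + 2), coeff j (a t) * coeff n ((j : ℂ⟦X⟧) * b t ^ (j - 1) * b') := by
    rw [Finset.sum_range_succ']
    simp only [Nat.cast_zero, zero_mul, map_zero, mul_zero, add_zero, Nat.add_sub_cancel]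
    rw [coeff_mul]
    have : ∀ p ∈ Finset.HasAntidiagonal.antidiagonal n,
        coeff p.1 (_root_.formalComp (derivative ℂ (a t)) (b t)) * coeff p.2 b' =
        ∑ j ∈ Finset.range (n + 1),
          coeff (j + 1) (a t) * (j + 1) * coeff p.1 (b t ^ j) * coeff p.2 b' := by
      intro p hp
      have hp' := Finset.HasAntidiagonal.mem_antidiagonal.1 hp
      rw [coeff_formalComp (hb0 t ht) (show p.1 < n + 1 by omega), Finset.sum_mul]
      simp only [coeff_derivative]
    rw [Finset.sum_congr rfl this, Finset.sum_comm]
    refine Finset.sum_congr rfl fun j _ => ?_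
    have : ((j + 1 : ℕ) : ℂ⟦X⟧) = C ((j : ℂ) + 1) := by simp
    rw [this, mul_assoc, coeff_C_mul, coeff_mul, Finset.mul_sum, Finset.mul_sum]
    exact Finset.sum_congr rfl fun p _ => by ring
  rw [key, ← Finset.sum_add_distrib]
  exact HasDerivWithinAt.fun_sum fun j _ => (ha j).mul (hb.pow j n)

/-- Solutions of `v' = c v` on `[0,1]` are exponentials. -/
theorem eq_exp_of_hasDerivWithinAt {c : ℂ} {v : ℝ → ℂ}
    (h : ∀ t ∈ Set.Icc (0 : ℝ) 1, HasDerivWithinAt v (c * v t) (Set.Icc 0 1) t) :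
    ∀ t ∈ Set.Icc (0 : ℝ) 1, v t = v 0 * Complex.exp (c * t) := by
  have hw : ∀ t ∈ Set.Icc (0 : ℝ) 1,
      HasDerivWithinAt (fun t : ℝ => Complex.exp (-c * t) * v t) 0 (Set.Icc 0 1) t := by
    intro t ht
    have h1 : HasDerivAt (fun t : ℝ => Complex.exp (-c * t)) (Complex.exp (-c * t) * (-c)) t := by
      have : HasDerivAt (fun t : ℝ => -c * (t : ℂ)) (-c) t := by
        simpa using (Complex.ofRealCLM.hasDerivAt (x := t)).const_mul (-c)
      exact this.cexp
    refine (h1.hasDerivWithinAt.mul (h t ht)).congr_deriv ?_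
    ring
  intro t ht
  have := constant_of_derivWithin_zero (fun s hs => (hw s hs).differentiableWithinAt)
    (fun s hs => (hw s (Set.Ico_subset_Icc_self hs)).derivWithin
      (uniqueDiffOn_Icc zero_lt_one s (Set.Ico_subset_Icc_self hs))) t ht
  simp only [Complex.ofReal_zero, mul_zero, Complex.exp_zero, one_mul] at this
  rw [← this, mul_assoc, mul_comm (v t), ← mul_assoc, ← Complex.exp_add]
  simp

/-- The transport equation `∂ₜ u = G ∂_y u`, where `G = μ y + o(y)`, determines `u` from its
initial value: the coefficients of `u` solve a triangular system of linear equations. -/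
theorem transport_unique {μ : ℂ} {G u : ℝ → ℂ⟦X⟧} (hG0 : ∀ t ∈ Set.Icc (0 : ℝ) 1, coeff 0 (G t) = 0)
    (hG1 : ∀ t ∈ Set.Icc (0 : ℝ) 1, coeff 1 (G t) = μ)
    (hu : ∀ t ∈ Set.Icc (0 : ℝ) 1, HasCoeffDeriv u (G t * derivative ℂ (u t)) t) (h0 : u 0 = 0) :
    ∀ t ∈ Set.Icc (0 : ℝ) 1, u t = 0 := by
  suffices ∀ n, ∀ t ∈ Set.Icc (0 : ℝ) 1, coeff n (u t) = 0 from fun t ht => by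
    ext n; simpa using this n t ht
  intro n
  induction n using Nat.strong_induction_on with
  | _ n ih =>
    have h1 : ∀ t ∈ Set.Icc (0 : ℝ) 1, coeff n (G t * derivative ℂ (u t)) =
        (μ * n) * coeff n (u t) := by
      intro t ht
      rw [coeff_mul]
      rcases n with _ | n
      · simp [hG0 t ht]
      · rw [Finset.sum_eq_single (1, n)]
        · simp [hG1 t ht, coeff_derivative]; ring
        · intro p hp hne
          have hp' := Finset.HasAntidiagonal.mem_antidiagonal.1 hp
          match hp1 : p.1 with
          | 0 => simp [hG0 t ht]
          | 1 => exact absurd (Prod.ext hp1 (by simp; omega)) hne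
          | j + 2 => rw [coeff_derivative, ih _ (by omega) t ht]; simp
        · intro hp
          exact absurd (Finset.HasAntidiagonal.mem_antidiagonal.2 (by simp; omega)) hp
    intro t ht
    have h2 := eq_exp_of_hasDerivWithinAt (c := μ * n) (v := fun t => coeff n (u t))
      (fun s hs => by simpa only [h1 s hs] using hu s hs n) t ht
    simpa [h0] using h2

theorem transport_unique' {μ : ℂ} {G u v : ℝ → ℂ⟦X⟧}
    (hG0 : ∀ t ∈ Set.Icc (0 : ℝ) 1, coeff 0 (G t) = 0)
    (hG1 : ∀ t ∈ Set.Icc (0 : ℝ) 1, coeff 1 (G t) = μ)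
    (hu : ∀ t ∈ Set.Icc (0 : ℝ) 1, HasCoeffDeriv u (G t * derivative ℂ (u t)) t)
    (hv : ∀ t ∈ Set.Icc (0 : ℝ) 1, HasCoeffDeriv v (G t * derivative ℂ (v t)) t)
    (h0 : u 0 = v 0) :
    ∀ t ∈ Set.Icc (0 : ℝ) 1, u t = v t := by
  intro t ht
  have := transport_unique (u := fun t => u t - v t) hG0 hG1
    (fun s hs => by simpa only [map_sub, mul_sub] using (hu s hs).sub (hv s hs)) (by simp [h0]) t ht
  exact sub_eq_zero.1 this

/-- A solution of the transport equation composed with a fixed series is again a solution. -/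
theorem HasCoeffDeriv.const_comp (ψ : ℂ⟦X⟧) {G u : ℝ → ℂ⟦X⟧} {t : ℝ}
    (ht : t ∈ Set.Icc (0 : ℝ) 1) (hu0 : ∀ s ∈ Set.Icc (0 : ℝ) 1, coeff 0 (u s) = 0)
    (hu : HasCoeffDeriv u (G t * derivative ℂ (u t)) t) :
    HasCoeffDeriv (fun s => _root_.formalComp ψ (u s))
      (G t * derivative ℂ (_root_.formalComp ψ (u t))) t := by
  have := HasCoeffDeriv.formalComp ht hu0 (hasCoeffDeriv_const ψ t) hu
  rw [derivative_formalComp _ (hu0 t ht)]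
  convert this using 1
  have : _root_.formalComp 0 (u t) = 0 := by simpa using formalComp_C 0 (u t)
  rw [this]; ring

/-! ### The Euler equation on the disc -/

/-- Termwise solution of `x a' + μ a = P` on the disc: dividing the `k`-th Taylor coefficient of
`P` by `k + μ` solves the equation up to the resonant terms, those with `k + μ = 0`. -/
theorem exists_euler_solution_mod_resonance {r : ℝ} {P : ℂ → ℂ} (hP : AnalyticOnNhd ℂ P (disc r))
    (μ : ℂ) :
    ∃ (a : ℂ → ℂ) (p : ℕ → ℂ), AnalyticOnNhd ℂ a (disc r) ∧ ∀ x ∈ disc r,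
      HasSum (fun k : ℕ => if (k : ℂ) + μ = 0 then p k * x ^ k else 0)
        (P x - (x * deriv a x + μ * a x)) := by
  set p : ℕ → ℂ := fun k => iteratedDeriv k P 0 / (k.factorial : ℂ) with hp
  have hPsum : ∀ x ∈ disc r, HasSum (fun k => p k * x ^ k) (P x) := by
    intro x hx
    convert! Complex.hasSum_taylorSeries_on_ball hP.differentiableOn hx using 1
    funext k
    simp only [hp, sub_zero, smul_eq_mul]
    ring
  set c : ℕ → ℂ := fun k => if (k : ℂ) + μ = 0 then 0 else p k / (k + μ) with hc
  have hsummable : ∀ ρ : ℝ, 0 ≤ ρ → ρ < r → Summable (fun k => ‖c k‖ * ρ ^ k) := by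
    intro ρ h0 hρ
    have h1 : Summable (fun k => ‖p k * (ρ : ℂ) ^ k‖) :=
      (hPsum ρ (by simpa [abs_of_nonneg h0] using hρ)).summable.norm
    refine Summable.of_norm_bounded_eventually_nat h1 ?_
    obtain ⟨N, hN⟩ := exists_nat_ge (‖μ‖ + 1)
    filter_upwards [eventually_ge_atTop N] with k hk
    have h2 : 1 ≤ ‖(k : ℂ) + μ‖ := by
      have h3 : ‖(k : ℂ)‖ ≤ ‖(k : ℂ) + μ‖ + ‖μ‖ := by
        simpa using norm_sub_le ((k : ℂ) + μ) μ
      have h4 : (N : ℝ) ≤ k := by exact_mod_cast hk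
      rw [Complex.norm_natCast] at h3
      linarith
    have h5 : ‖c k‖ ≤ ‖p k‖ := by
      have : (k : ℂ) + μ ≠ 0 := fun h => by rw [h, norm_zero] at h2; linarith
      simp only [hc, if_neg this, norm_div]
      exact div_le_self (norm_nonneg _) h2
    simp only [norm_mul, norm_norm, norm_pow, Complex.norm_real]
    gcongr
  have hlocal : ∀ x ∈ disc r, ∃ ρ : ℝ, x ∈ disc ρ ∧ disc ρ ⊆ disc r ∧
      Summable (fun k => ‖c k‖ * ρ ^ k) := by
    intro x hx
    have hx' : ‖x‖ < r := by simpa using hx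
    obtain ⟨ρ, h1, h2⟩ := exists_between hx'
    exact ⟨ρ, by simpa using h1, Metric.ball_subset_ball h2.le,
      hsummable ρ ((norm_nonneg _).trans h1.le) h2⟩
  have hbound : ∀ ρ : ℝ, ∀ k : ℕ, ∀ w ∈ disc ρ, ‖c k * w ^ k‖ ≤ ‖c k‖ * ρ ^ k := by
    intro ρ k w hw
    have hw' : ‖w‖ < ρ := by simpa using hw
    rw [norm_mul, norm_pow]
    gcongr
  have hdiff : ∀ k : ℕ, ∀ s : Set ℂ, DifferentiableOn ℂ (fun w : ℂ => c k * w ^ k) s := by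
    intro k s
    fun_prop
  refine ⟨fun x => ∑' k, c k * x ^ k, p, ?_, ?_⟩
  · intro x hx
    obtain ⟨ρ, hxρ, -, hs⟩ := hlocal x hx
    exact (Complex.differentiableOn_tsum_of_summable_norm hs (fun k => hdiff k _) Metric.isOpen_ball
      (hbound ρ)).analyticOnNhd Metric.isOpen_ball x hxρ
  · intro x hx
    obtain ⟨ρ, hxρ, -, hs⟩ := hlocal x hx
    have h1 := Complex.hasSum_deriv_of_summable_norm hs (fun k => hdiff k _) Metric.isOpen_ball
      (hbound ρ) hxρ
    have h2 : HasSum (fun k => c k * x ^ k) (∑' k, c k * x ^ k) :=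
      (Summable.of_norm_bounded hs fun k => hbound ρ k x hxρ).hasSum
    have h3 := (hPsum x hx).sub ((h1.mul_left x).add (h2.mul_left μ))
    convert! h3 using 1
    funext k
    have h4 : x * deriv (fun w : ℂ => c k * w ^ k) x = k * (c k * x ^ k) := by
      rw [deriv_const_mul_field, deriv_pow_field]
      rcases k with _ | k
      · simp
      · simp only [Nat.add_sub_cancel]; ring
    rw [h4]
    simp only [hc]
    split_ifs with h
    · ring
    · field_simp
      ring

theorem exists_euler_solution_of_not_resonant {r : ℝ} {P : ℂ → ℂ}
    (hP : AnalyticOnNhd ℂ P (disc r)) {μ : ℂ} (hμ : ∀ k : ℕ, (k : ℂ) + μ ≠ 0) :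
    ∃ a : ℂ → ℂ, AnalyticOnNhd ℂ a (disc r) ∧ ∀ x ∈ disc r, x * deriv a x + μ * a x = P x := by
  obtain ⟨a, p, ha, h⟩ := exists_euler_solution_mod_resonance hP μ
  refine ⟨a, ha, fun x hx => ?_⟩
  have h1 := h x hx
  simp only [hμ, if_false] at h1
  exact (sub_eq_zero.1 (h1.unique hasSum_zero)).symm

theorem exists_euler_solution_of_resonant {r : ℝ} {P : ℂ → ℂ}
    (hP : AnalyticOnNhd ℂ P (disc r)) (m : ℕ) :
    ∃ (a : ℂ → ℂ) (p : ℂ), AnalyticOnNhd ℂ a (disc r) ∧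
      ∀ x ∈ disc r, x * deriv a x + -(m : ℂ) * a x = P x - p * x ^ m := by
  obtain ⟨a, p, ha, h⟩ := exists_euler_solution_mod_resonance hP (-(m : ℂ))
  refine ⟨a, p m, ha, fun x hx => ?_⟩
  have h2 := (h x hx).unique (hasSum_single m fun k hk => by
    rw [if_neg]
    rw [← sub_eq_add_neg, sub_eq_zero]
    exact_mod_cast hk)
  simp only [add_neg_cancel, if_true] at h2
  linear_combination -h2

/-! ### The Euler equation along the loop -/

theorem hasDerivAt_loop (x₀ : ℂ) (t : ℝ) :
    HasDerivAt (fun s : ℝ => (loop x₀ s).1) (2 * Real.pi * Complex.I * (loop x₀ t).1) t := by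
  have h : HasDerivAt (fun s : ℝ => 2 * Real.pi * Complex.I * (s : ℂ)) (2 * Real.pi * Complex.I) t := by
    simpa using (Complex.ofRealCLM.hasDerivAt (x := t)).const_mul (2 * Real.pi * Complex.I)
  refine (h.cexp.const_mul x₀).congr_deriv ?_
  simp only [loop]
  ring

theorem norm_loop (x₀ : ℂ) (t : ℝ) : ‖(loop x₀ t).1‖ = ‖x₀‖ := by
  have : 2 * Real.pi * Complex.I * (t : ℂ) = ((2 * Real.pi * t : ℝ) : ℂ) * Complex.I := by
    push_cast; ring
  rw [loop, norm_mul, this, Complex.norm_exp_ofReal_mul_I, mul_one]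

theorem loop_mem_disc {r : ℝ} {x₀ : ℂ} (hx₀ : x₀ ∈ disc r) (t : ℝ) : (loop x₀ t).1 ∈ disc r := by
  simpa [norm_loop] using hx₀

theorem loop_ne_zero {x₀ : ℂ} (hx₀ : x₀ ≠ 0) (t : ℝ) : (loop x₀ t).1 ≠ 0 := by
  rw [← norm_pos_iff, norm_loop]
  exact norm_pos_iff.2 hx₀

theorem loop_zero (x₀ : ℂ) : loop x₀ 0 = (x₀, 0) := by simp [loop]

theorem loop_one (x₀ : ℂ) : loop x₀ 1 = (x₀, 0) := by simp [loop, Complex.exp_two_pi_mul_I]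

theorem loop_eq (x₀ : ℂ) (t : ℝ) : loop x₀ t = ((loop x₀ t).1, 0) := rfl

/-- A periodic solution of `u' = 2iπ (P - μ u)` along the loop is the restriction of a solution
`a` of `x a' + μ a = P` that is holomorphic on the whole disc, provided that `μ` is not a positive
integer: for `μ = m > 0` the meromorphic function `x⁻ᵐ` solves the homogeneous equation. -/
theorem exists_euler_solution_extending {r : ℝ} {P : ℂ → ℂ} (hP : AnalyticOnNhd ℂ P (disc r))
    {x₀ : ℂ} (hx₀ : x₀ ∈ disc r) (hx₀' : x₀ ≠ 0) {μ : ℂ} (hμ : ∀ m : ℕ, 0 < m → μ ≠ m)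
    {u : ℝ → ℂ} (hu : ∀ t ∈ Set.Icc (0 : ℝ) 1, HasDerivWithinAt u
      (2 * Real.pi * Complex.I * (P (loop x₀ t).1 - μ * u t)) (Set.Icc 0 1) t) (h01 : u 1 = u 0) :
    ∃ a : ℂ → ℂ, AnalyticOnNhd ℂ a (disc r) ∧ (∀ x ∈ disc r, x * deriv a x + μ * a x = P x) ∧
      ∀ t ∈ Set.Icc (0 : ℝ) 1, a (loop x₀ t).1 = u t := by
  have hcomp : ∀ a : ℂ → ℂ, AnalyticOnNhd ℂ a (disc r) → ∀ t : ℝ,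
      HasDerivAt (fun s : ℝ => a (loop x₀ s).1)
        (2 * Real.pi * Complex.I * ((loop x₀ t).1 * deriv a (loop x₀ t).1)) t := by
    intro a ha t
    have h1 := (ha _ (loop_mem_disc hx₀ t)).differentiableAt.hasDerivAt
    refine (h1.comp t (hasDerivAt_loop x₀ t)).congr_deriv ?_
    ring
  have hpi : 2 * (Real.pi : ℂ) * Complex.I ≠ 0 := by simp [Real.pi_ne_zero]
  by_cases hres : ∀ k : ℕ, (k : ℂ) + μ ≠ 0
  · obtain ⟨a, ha, hode⟩ := exists_euler_solution_of_not_resonant hP hres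
    have hv := eq_exp_of_hasDerivWithinAt (c := -(2 * Real.pi * Complex.I * μ))
      (v := fun t => u t - a (loop x₀ t).1) fun t ht => by
        refine ((hu t ht).sub (hcomp a ha t).hasDerivWithinAt).congr_deriv ?_
        rw [← hode _ (loop_mem_disc hx₀ t)]
        ring
    have hv0 : u 0 - a (loop x₀ 0).1 = 0 := by
      have h1 := hv 1 (by simp)
      simp only [h01, loop_one, loop_zero] at h1 ⊢
      by_contra hne
      have h2 : Complex.exp (-(2 * Real.pi * Complex.I * μ) * (1 : ℝ)) = 1 :=
        mul_left_cancel₀ hne (by rw [← h1, mul_one])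
      obtain ⟨n, hn⟩ := Complex.exp_eq_one_iff.1 h2
      have hμn : μ = ((-n : ℤ) : ℂ) := by
        apply mul_left_cancel₀ hpi
        push_cast at hn ⊢
        linear_combination -hn
      rcases lt_or_ge 0 (-n) with h | h
      · apply hμ (-n).toNat (by omega)
        rw [hμn]
        have : (((-n).toNat : ℤ) : ℂ) = ((-n : ℤ) : ℂ) := by rw [Int.toNat_of_nonneg h.le]
        exact_mod_cast this.symm
      · apply hres n.toNat
        have : ((n.toNat : ℤ) : ℂ) = (n : ℂ) := by rw [Int.toNat_of_nonneg (by omega)]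
        rw [hμn]
        push_cast at this ⊢
        rw [this]; ring
    refine ⟨a, ha, hode, fun t ht => ?_⟩
    have h1 := hv t ht
    rw [hv0, zero_mul, sub_eq_zero] at h1
    exact h1.symm
  · push Not at hres
    obtain ⟨m, hm⟩ := hres
    obtain rfl : μ = -(m : ℂ) := by linear_combination hm
    obtain ⟨a, p, ha, hode⟩ := exists_euler_solution_of_resonant hP m
    -- `w = exp(-2iπmt) (u - a)` has the constant derivative `2iπ p x₀ ^ m`
    -- so that periodicity forces the resonant coefficient `p` to vanish
    have hloop : ∀ t : ℝ, (loop x₀ t).1 ^ m =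
        x₀ ^ m * Complex.exp (2 * Real.pi * Complex.I * m * t) := by
      intro t
      simp only [loop, mul_pow, ← Complex.exp_nat_mul]
      ring_nf
    have hp : p = 0 := by
      set e : ℝ → ℂ := fun t => Complex.exp (-(2 * Real.pi * Complex.I * m) * t) with he
      have hde : ∀ t : ℝ, HasDerivAt e (e t * -(2 * Real.pi * Complex.I * m)) t := by
        intro t
        have : HasDerivAt (fun t : ℝ => -(2 * Real.pi * Complex.I * m) * (t : ℂ))
            (-(2 * Real.pi * Complex.I * m)) t := by
          simpa using (Complex.ofRealCLM.hasDerivAt (x := t)).const_mul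
            (-(2 * Real.pi * Complex.I * m))
        exact this.cexp
      have hlin : ∀ t : ℝ, HasDerivAt (fun t : ℝ => (2 * Real.pi * Complex.I * p * x₀ ^ m) * (t : ℂ))
            (2 * Real.pi * Complex.I * p * x₀ ^ m) t := by
        intro t
        simpa using (Complex.ofRealCLM.hasDerivAt (x := t)).const_mul
          (2 * Real.pi * Complex.I * p * x₀ ^ m)
      have hw : ∀ t ∈ Set.Icc (0 : ℝ) 1, HasDerivWithinAt
          (fun t : ℝ => e t * (u t - a (loop x₀ t).1) - (2 * Real.pi * Complex.I * p * x₀ ^ m) * t)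
          0 (Set.Icc 0 1) t := by
        intro t ht
        refine (((hde t).hasDerivWithinAt.mul ((hu t ht).sub (hcomp a ha t).hasDerivWithinAt)).sub
          (hlin t).hasDerivWithinAt).congr_deriv ?_
        have h1 := hode _ (loop_mem_disc hx₀ t)
        have h2 : e t * (loop x₀ t).1 ^ m = x₀ ^ m := by
          rw [hloop, he, mul_left_comm, ← Complex.exp_add]
          ring_nf
          simp
        simp only [Pi.sub_apply]
        linear_combination (-2 * Real.pi * Complex.I * e t) * h1 + 2 * Real.pi * Complex.I * p * h2
      have h3 := constant_of_derivWithin_zero (fun s hs => (hw s hs).differentiableWithinAt)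
        (fun s hs => (hw s (Set.Ico_subset_Icc_self hs)).derivWithin
          (uniqueDiffOn_Icc zero_lt_one s (Set.Ico_subset_Icc_self hs))) 1 (by simp)
      have he1 : e 1 = 1 := by
        simp only [he, Complex.ofReal_one, mul_one]
        rw [Complex.exp_eq_one_iff]
        exact ⟨-m, by push_cast; ring⟩
      have he0 : e 0 = 1 := by simp [he]
      rw [he1, he0, h01, loop_one, loop_zero] at h3
      have h4 : 2 * (Real.pi : ℂ) * Complex.I * p * x₀ ^ m = 0 := by
        simpa using h3
      simpa [Real.pi_ne_zero, hx₀'] using h4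
    subst hp
    have hode' : ∀ x ∈ disc r, x * deriv a x + -(m : ℂ) * a x = P x := fun x hx => by
      simpa using hode x hx
    have hv := eq_exp_of_hasDerivWithinAt (c := 2 * Real.pi * Complex.I * m)
      (v := fun t => u t - a (loop x₀ t).1) fun t ht => by
        refine ((hu t ht).sub (hcomp a ha t).hasDerivWithinAt).congr_deriv ?_
        rw [← hode' _ (loop_mem_disc hx₀ t)]
        ring
    set q : ℂ := (u 0 - a (loop x₀ 0).1) / x₀ ^ m with hq
    refine ⟨fun x => a x + q * x ^ m, fun x hx => ?_, fun x hx => ?_, fun t ht => ?_⟩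
    · exact (ha x hx).add (by fun_prop)
    · have h1 : HasDerivAt (fun x => a x + q * x ^ m) (deriv a x + q * (m * x ^ (m - 1))) x :=
        ((ha x hx).differentiableAt.hasDerivAt).add ((hasDerivAt_pow m x).const_mul q)
      rw [h1.deriv, ← hode' x hx]
      have h2 : x * (m * x ^ (m - 1)) = m * x ^ m := by
        rcases m with _ | m
        · simp
        · simp only [Nat.add_sub_cancel]; ring
      linear_combination q * h2
    · have h1 := hv t ht
      have h2 : q * (loop x₀ t).1 ^ m =
          (u 0 - a (loop x₀ 0).1) * Complex.exp (2 * Real.pi * Complex.I * m * t) := by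
        rw [hloop, hq]
        have : x₀ ^ m ≠ 0 := pow_ne_zero _ hx₀'
        field_simp
      simp only at h1 ⊢
      rw [h2, ← h1]
      ring

/-! ### Taylor series of analytic functions of one variable -/

theorem coeff_taylorAtZero (φ : ℂ → ℂ) (n : ℕ) :
    coeff n (taylorAtZero φ) = iteratedDeriv n φ 0 / (n.factorial : ℂ) := coeff_mk _ _

theorem coeff_zero_taylorAtZero (φ : ℂ → ℂ) : coeff 0 (taylorAtZero φ) = φ 0 := by
  simp [coeff_taylorAtZero]

theorem coeff_one_taylorAtZero (φ : ℂ → ℂ) : coeff 1 (taylorAtZero φ) = deriv φ 0 := by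
  simp [coeff_taylorAtZero, iteratedDeriv_one]

theorem taylorAtZero_congr {φ χ : ℂ → ℂ} (h : φ =ᶠ[𝓝 0] χ) : taylorAtZero φ = taylorAtZero χ := by
  ext n
  rw [coeff_taylorAtZero, coeff_taylorAtZero, h.iteratedDeriv_eq]

theorem taylorAtZero_eq_mk {φ : ℂ → ℂ} {a : ℕ → ℂ}
    (h : ∀ᶠ z in 𝓝 0, HasSum (fun n => a n * z ^ n) (φ z)) : taylorAtZero φ = PowerSeries.mk a := by
  have h1 : HasFPowerSeriesAt φ (FormalMultilinearSeries.ofScalars ℂ a) 0 := by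
    rw [hasFPowerSeriesAt_iff]
    filter_upwards [h] with z hz
    simpa [FormalMultilinearSeries.coeff_ofScalars, mul_comm] using hz
  have h2 := h1.analyticAt.hasFPowerSeriesAt.eq_formalMultilinearSeries h1
  ext n
  have h3 := congrArg (fun p => FormalMultilinearSeries.coeff p n) h2
  simpa [FormalMultilinearSeries.coeff_ofScalars, coeff_taylorAtZero] using h3

theorem eventuallyEq_of_taylorAtZero_eq {φ χ : ℂ → ℂ} (hφ : AnalyticAt ℂ φ 0)
    (hχ : AnalyticAt ℂ χ 0) (h : taylorAtZero φ = taylorAtZero χ) : φ =ᶠ[𝓝 0] χ := by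
  have h1 := hφ.hasFPowerSeriesAt
  have h2 := hχ.hasFPowerSeriesAt
  have h3 : (fun n => iteratedDeriv n φ 0 / (n.factorial : ℂ)) =
      fun n => iteratedDeriv n χ 0 / (n.factorial : ℂ) := by
    funext n
    rw [← coeff_taylorAtZero, ← coeff_taylorAtZero, h]
  rw [h3] at h1
  rw [hasFPowerSeriesAt_iff] at h1 h2
  filter_upwards [h1, h2] with z hz1 hz2
  simpa using hz1.unique hz2

theorem taylorAtZero_const (a : ℂ) : taylorAtZero (fun _ => a) = C a := by
  ext n
  rw [coeff_taylorAtZero, coeff_C, iteratedDeriv_const]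
  split_ifs with h <;> simp [h]

theorem taylorAtZero_id : taylorAtZero (fun z => z) = X := by
  ext n
  rw [coeff_taylorAtZero, coeff_X, iteratedDeriv_fun_id_zero]
  split_ifs with h <;> simp [h]

theorem taylorAtZero_add {φ χ : ℂ → ℂ} (hφ : AnalyticAt ℂ φ 0) (hχ : AnalyticAt ℂ χ 0) :
    taylorAtZero (fun z => φ z + χ z) = taylorAtZero φ + taylorAtZero χ := by
  ext n
  rw [map_add, coeff_taylorAtZero, coeff_taylorAtZero, coeff_taylorAtZero,
    iteratedDeriv_fun_add hφ.contDiffAt hχ.contDiffAt, add_div]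

theorem taylorAtZero_mul {φ χ : ℂ → ℂ} (hφ : AnalyticAt ℂ φ 0) (hχ : AnalyticAt ℂ χ 0) :
    taylorAtZero (fun z => φ z * χ z) = taylorAtZero φ * taylorAtZero χ := by
  ext n
  rw [coeff_mul, Finset.Nat.sum_antidiagonal_eq_sum_range_succ_mk, coeff_taylorAtZero,
    iteratedDeriv_fun_mul hφ.contDiffAt hχ.contDiffAt, Finset.sum_div]
  refine Finset.sum_congr rfl fun i hi => ?_
  have hi' : i ≤ n := Nat.lt_succ_iff.1 (Finset.mem_range.1 hi)
  rw [coeff_taylorAtZero, coeff_taylorAtZero, Nat.cast_choose ℂ hi']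
  have h1 : (n.factorial : ℂ) ≠ 0 := by exact_mod_cast n.factorial_ne_zero
  have h2 : (i.factorial : ℂ) ≠ 0 := by exact_mod_cast i.factorial_ne_zero
  have h3 : ((n - i).factorial : ℂ) ≠ 0 := by exact_mod_cast (n - i).factorial_ne_zero
  field_simp

theorem taylorAtZero_neg (φ : ℂ → ℂ) : taylorAtZero (fun z => -φ z) = -taylorAtZero φ := by
  ext n
  rw [map_neg, coeff_taylorAtZero, coeff_taylorAtZero, iteratedDeriv_fun_neg, neg_div]

theorem taylorAtZero_deriv (φ : ℂ → ℂ) :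
    taylorAtZero (deriv φ) = derivative ℂ (taylorAtZero φ) := by
  ext n
  rw [coeff_derivative, coeff_taylorAtZero, coeff_taylorAtZero, iteratedDeriv_succ',
    Nat.factorial_succ]
  have h1 : (n.factorial : ℂ) ≠ 0 := by exact_mod_cast n.factorial_ne_zero
  have h2 : (n : ℂ) + 1 ≠ 0 := by exact_mod_cast n.succ_ne_zero
  push_cast
  field_simp

/-- The Taylor series of a composite is the composite of the Taylor series; by induction on the
degree, dividing the outer function by its variable. -/
theorem taylorAtZero_comp {φ h : ℂ → ℂ} (hφ : AnalyticAt ℂ φ 0) (hh : AnalyticAt ℂ h 0)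
    (h0 : h 0 = 0) :
    taylorAtZero (fun z => φ (h z)) = formalComp (taylorAtZero φ) (taylorAtZero h) := by
  have hT : coeff 0 (taylorAtZero h) = 0 := by rw [coeff_zero_taylorAtZero, h0]
  ext n
  induction n using Nat.strong_induction_on generalizing φ with
  | _ n ih =>
    set χ := dslope φ 0 with hχ
    have hχa : AnalyticAt ℂ χ 0 := by
      obtain ⟨p, hp⟩ := hφ
      exact ⟨_, hp.has_fpower_series_dslope_fslope⟩
    have hφχ : ∀ z, φ z = φ 0 + z * χ z := by
      intro z
      have := sub_smul_dslope φ 0 z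
      rw [sub_zero, smul_eq_mul] at this
      rw [hχ, this]; ring
    have hcomp : ∀ g : ℂ → ℂ, AnalyticAt ℂ g 0 → AnalyticAt ℂ (fun z => g (h z)) 0 := by
      intro g hg
      exact AnalyticAt.fun_comp (by rwa [h0]) hh
    have hid : AnalyticAt ℂ (fun z : ℂ => z) 0 := analyticAt_id
    have e1 : taylorAtZero φ = C (φ 0) + X * taylorAtZero χ := by
      rw [← taylorAtZero_id, ← taylorAtZero_mul hid hχa, ← taylorAtZero_const,
        ← taylorAtZero_add analyticAt_const (hid.fun_mul hχa)]
      exact congrArg _ (funext hφχ)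
    have e2 : taylorAtZero (fun z => φ (h z)) =
        C (φ 0) + taylorAtZero h * taylorAtZero (fun z => χ (h z)) := by
      rw [← taylorAtZero_mul hh (hcomp χ hχa), ← taylorAtZero_const,
        ← taylorAtZero_add analyticAt_const (hh.fun_mul (hcomp χ hχa))]
      exact congrArg _ (funext fun z => hφχ (h z))
    rw [e1, e2, formalComp_add _ _ hT, formalComp_mul _ _ hT, formalComp_C, formalComp_X hT, map_add,
      map_add, coeff_mul, coeff_mul]
    congr 1
    refine Finset.sum_congr rfl fun p hp => ?_
    have hp' := Finset.HasAntidiagonal.mem_antidiagonal.1 hp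
    match hp1 : p.1 with
    | 0 => rw [hT, zero_mul, zero_mul]
    | j + 1 => rw [ih _ (by omega) hχa]

/-! ### Expansion in powers of `y` of analytic functions of `(x, y)` -/

/-- The expansion of `F(x, y)` in powers of `y`, for fixed `x`. -/
noncomputable def yTaylor (F : ℂ × ℂ → ℂ) (x : ℂ) : ℂ⟦X⟧ := taylorAtZero fun y => F (x, y)

/-- The partial derivative with respect to `x`. -/
noncomputable def partialX (F : ℂ × ℂ → ℂ) (q : ℂ × ℂ) : ℂ := fderiv ℂ F q (1, 0)

/-- The partial derivative with respect to `y`. -/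
noncomputable def partialY (F : ℂ × ℂ → ℂ) (q : ℂ × ℂ) : ℂ := fderiv ℂ F q (0, 1)

theorem analyticAt_fderiv_apply {F : ℂ × ℂ → ℂ} {q : ℂ × ℂ} (h : AnalyticAt ℂ F q) (v : ℂ × ℂ) :
    AnalyticAt ℂ (fun q => fderiv ℂ F q v) q :=
  ((ContinuousLinearMap.apply ℂ ℂ v).analyticAt _).comp h.fderiv

theorem AnalyticAt.partialX {F : ℂ × ℂ → ℂ} {q : ℂ × ℂ} (h : AnalyticAt ℂ F q) :
    AnalyticAt ℂ (partialX F) q := analyticAt_fderiv_apply h _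

theorem AnalyticAt.partialY {F : ℂ × ℂ → ℂ} {q : ℂ × ℂ} (h : AnalyticAt ℂ F q) :
    AnalyticAt ℂ (partialY F) q := analyticAt_fderiv_apply h _

theorem analyticAt_slice {F : ℂ × ℂ → ℂ} {x y : ℂ} (h : AnalyticAt ℂ F (x, y)) :
    AnalyticAt ℂ (fun y => F (x, y)) y :=
  AnalyticAt.fun_comp h (analyticAt_const.prod analyticAt_id)

theorem analyticAt_slice_left {F : ℂ × ℂ → ℂ} {x y : ℂ} (h : AnalyticAt ℂ F (x, y)) :
    AnalyticAt ℂ (fun x => F (x, y)) x :=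
  AnalyticAt.fun_comp h (analyticAt_id.prod analyticAt_const)

theorem eventually_analyticAt_slice {F : ℂ × ℂ → ℂ} {x y : ℂ} (h : AnalyticAt ℂ F (x, y)) :
    ∀ᶠ y' in 𝓝 y, AnalyticAt ℂ F (x, y') :=
  (Continuous.prodMk_right x).continuousAt.eventually h.eventually_analyticAt

theorem eventually_analyticAt_slice_left {F : ℂ × ℂ → ℂ} {x y : ℂ} (h : AnalyticAt ℂ F (x, y)) :
    ∀ᶠ x' in 𝓝 x, AnalyticAt ℂ F (x', y) :=
  (Continuous.prodMk_left y).continuousAt.eventually h.eventually_analyticAt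

theorem hasDerivAt_slice {F : ℂ × ℂ → ℂ} {x y : ℂ} (h : AnalyticAt ℂ F (x, y)) :
    HasDerivAt (fun y => F (x, y)) (partialY F (x, y)) y := by
  have h1 : HasDerivAt (fun y : ℂ => (x, y)) ((0 : ℂ), (1 : ℂ)) y :=
    (hasDerivAt_const y x).prodMk (hasDerivAt_id y)
  exact h.differentiableAt.hasFDerivAt.comp_hasDerivAt y h1

theorem hasDerivAt_slice_left {F : ℂ × ℂ → ℂ} {x y : ℂ} (h : AnalyticAt ℂ F (x, y)) :
    HasDerivAt (fun x => F (x, y)) (partialX F (x, y)) x := by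
  have h1 : HasDerivAt (fun x : ℂ => (x, y)) ((1 : ℂ), (0 : ℂ)) x :=
    (hasDerivAt_id x).prodMk (hasDerivAt_const x y)
  exact h.differentiableAt.hasFDerivAt.comp_hasDerivAt x h1

theorem fderiv_apply_eq_partial (F : ℂ × ℂ → ℂ) (q v : ℂ × ℂ) :
    fderiv ℂ F q v = v.1 * partialX F q + v.2 * partialY F q := by
  have : v = v.1 • ((1 : ℂ), (0 : ℂ)) + v.2 • ((0 : ℂ), (1 : ℂ)) := by
    ext <;> simp
  conv_lhs => rw [this, map_add, map_smul, map_smul]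
  rfl

theorem yTaylor_partialY {F : ℂ × ℂ → ℂ} {x : ℂ} (h : AnalyticAt ℂ F (x, 0)) :
    yTaylor (partialY F) x = derivative ℂ (yTaylor F x) := by
  rw [yTaylor, yTaylor, ← taylorAtZero_deriv]
  refine taylorAtZero_congr ?_
  filter_upwards [eventually_analyticAt_slice h] with y hy
  exact (hasDerivAt_slice hy).deriv.symm

theorem AnalyticAt.partialY_iterate {F : ℂ × ℂ → ℂ} {q : ℂ × ℂ} (h : AnalyticAt ℂ F q) (n : ℕ) :
    AnalyticAt ℂ (_root_.partialY^[n] F) q := by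
  induction n generalizing F with
  | zero => exact h
  | succ n ih => exact ih h.partialY

theorem coeff_yTaylor {F : ℂ × ℂ → ℂ} {x : ℂ} (h : AnalyticAt ℂ F (x, 0)) (n : ℕ) :
    coeff n (yTaylor F x) = (n.factorial : ℂ)⁻¹ * (partialY^[n] F) (x, 0) := by
  induction n generalizing F with
  | zero => simp [yTaylor, coeff_zero_taylorAtZero]
  | succ n ih =>
    have h1 := ih h.partialY
    rw [yTaylor_partialY h, coeff_derivative] at h1
    rw [Function.iterate_succ_apply, Nat.factorial_succ]
    have h2 : (n : ℂ) + 1 ≠ 0 := by exact_mod_cast n.succ_ne_zero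
    push_cast
    rw [mul_inv, mul_assoc, ← h1]
    field_simp

theorem partialY_congr {F G : ℂ × ℂ → ℂ} {q : ℂ × ℂ} (h : F =ᶠ[𝓝 q] G) :
    partialY F =ᶠ[𝓝 q] partialY G := by
  filter_upwards [h.fderiv (𝕜 := ℂ)] with p hp
  rw [partialY, partialY, hp]

theorem partialX_congr {F G : ℂ × ℂ → ℂ} {q : ℂ × ℂ} (h : F =ᶠ[𝓝 q] G) :
    partialX F =ᶠ[𝓝 q] partialX G := by
  filter_upwards [h.fderiv (𝕜 := ℂ)] with p hp
  rw [partialX, partialX, hp]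

theorem partialY_iterate_congr {F G : ℂ × ℂ → ℂ} {q : ℂ × ℂ} (h : F =ᶠ[𝓝 q] G) (n : ℕ) :
    partialY^[n] F =ᶠ[𝓝 q] partialY^[n] G := by
  induction n generalizing F G with
  | zero => exact h
  | succ n ih => exact ih (partialY_congr h)

theorem partialX_partialY_comm {F : ℂ × ℂ → ℂ} {q : ℂ × ℂ} (h : AnalyticAt ℂ F q) :
    partialX (partialY F) =ᶠ[𝓝 q] partialY (partialX F) := by
  filter_upwards [h.eventually_analyticAt] with p hp
  have hd : DifferentiableAt ℂ (fderiv ℂ F) p := hp.fderiv.differentiableAt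
  have key : ∀ v w : ℂ × ℂ, fderiv ℂ (fun q => fderiv ℂ F q v) p w =
      fderiv ℂ (fderiv ℂ F) p w v := by
    intro v w
    have h1 := ((ContinuousLinearMap.apply ℂ ℂ v).hasFDerivAt).comp p hd.hasFDerivAt
    have h2 : fderiv ℂ (fun q => fderiv ℂ F q v) p = _ := h1.fderiv
    rw [h2]
    rfl
  have hs : IsSymmSndFDerivAt ℂ F p := hp.contDiffAt.isSymmSndFDerivAt (n := ⊤) le_top
  change fderiv ℂ (fun q => fderiv ℂ F q (0, 1)) p (1, 0) =
    fderiv ℂ (fun q => fderiv ℂ F q (1, 0)) p (0, 1)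
  rw [key, key]
  exact hs.eq _ _

theorem partialX_partialY_iterate_comm {F : ℂ × ℂ → ℂ} {q : ℂ × ℂ} (h : AnalyticAt ℂ F q) (n : ℕ) :
    partialX (partialY^[n] F) =ᶠ[𝓝 q] partialY^[n] (partialX F) := by
  induction n generalizing F with
  | zero => exact EventuallyEq.rfl
  | succ n ih =>
    exact (ih h.partialY).trans (partialY_iterate_congr (partialX_partialY_comm h) n)

theorem analyticAt_coeff_yTaylor {F : ℂ × ℂ → ℂ} {x : ℂ} (h : AnalyticAt ℂ F (x, 0)) (n : ℕ) :
    AnalyticAt ℂ (fun x => coeff n (yTaylor F x)) x := by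
  refine (analyticAt_const.mul (analyticAt_slice_left (h.partialY_iterate n))).congr ?_
    (f := fun x => (n.factorial : ℂ)⁻¹ * (partialY^[n] F) (x, 0))
  filter_upwards [eventually_analyticAt_slice_left h] with x' hx'
  exact (coeff_yTaylor hx' n).symm

/-- Expansion in powers of `y` commutes with differentiation in `x`. -/
theorem hasDerivAt_coeff_yTaylor {F : ℂ × ℂ → ℂ} {x : ℂ} (h : AnalyticAt ℂ F (x, 0)) (n : ℕ) :
    HasDerivAt (fun x => coeff n (yTaylor F x)) (coeff n (yTaylor (partialX F) x)) x := by
  rw [coeff_yTaylor h.partialX, ← (partialX_partialY_iterate_comm h n).self_of_nhds]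
  refine ((hasDerivAt_slice_left (h.partialY_iterate n)).const_mul _).congr_of_eventuallyEq ?_
  filter_upwards [eventually_analyticAt_slice_left h] with x' hx'
  exact coeff_yTaylor hx' n

theorem yTaylor_congr {F G : ℂ × ℂ → ℂ} {x : ℂ} (h : F =ᶠ[𝓝 (x, 0)] G) :
    yTaylor F x = yTaylor G x :=
  taylorAtZero_congr ((Continuous.prodMk_right x).continuousAt.eventually h)

/-- An analytic germ is determined by its expansion in powers of `y`. -/
theorem eventuallyEq_of_yTaylor_eq {F G : ℂ × ℂ → ℂ} {x₀ : ℂ} (hF : AnalyticAt ℂ F (x₀, 0))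
    (hG : AnalyticAt ℂ G (x₀, 0)) (h : ∀ᶠ x in 𝓝 x₀, yTaylor F x = yTaylor G x) :
    F =ᶠ[𝓝 (x₀, 0)] G := by
  have h1 := (hF.eventually_analyticAt.and hG.eventually_analyticAt)
  rw [nhds_prod_eq] at h1 ⊢
  obtain ⟨p, hp, q, hq, hpq⟩ := eventually_prod_iff.1 h1
  obtain ⟨δ, hδ, hball⟩ := Metric.eventually_nhds_iff_ball.1 hq
  have hq' : ∀ᶠ y in 𝓝 (0 : ℂ), y ∈ Metric.ball (0 : ℂ) δ := Metric.ball_mem_nhds _ hδ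
  refine eventually_prod_iff.2 ⟨fun x => p x ∧ yTaylor F x = yTaylor G x, hp.and h, _, hq', ?_⟩
  rintro x ⟨hx, hT⟩ y hy
  have hFx : AnalyticOnNhd ℂ (fun y => F (x, y)) (Metric.ball 0 δ) := fun y hy =>
    analyticAt_slice (hpq hx (hball y hy)).1
  have hGx : AnalyticOnNhd ℂ (fun y => G (x, y)) (Metric.ball 0 δ) := fun y hy =>
    analyticAt_slice (hpq hx (hball y hy)).2
  have h0 : (0 : ℂ) ∈ Metric.ball (0 : ℂ) δ := Metric.mem_ball_self hδ
  exact hFx.eqOn_of_preconnected_of_eventuallyEq hGx (convex_ball 0 δ).isPreconnected h0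
    (eventuallyEq_of_taylorAtZero_eq (hFx 0 h0) (hGx 0 h0) hT) hy

/-! ### The transport equation satisfied by first integrals -/

/-- The expansion `(lam + f(x, y)) y` in powers of `y`, so that the foliation is the differential
equation `x dy/dx = leafSlope`. -/
noncomputable def leafSlope (lam : ℂ) (f : ℂ × ℂ → ℂ) (x : ℂ) : ℂ⟦X⟧ := (C lam + yTaylor f x) * X

theorem coeff_zero_leafSlope (lam : ℂ) (f : ℂ × ℂ → ℂ) (x : ℂ) : coeff 0 (leafSlope lam f x) = 0 := by
  simp [leafSlope]

theorem coeff_one_leafSlope {lam : ℂ} {f : ℂ × ℂ → ℂ} {x : ℂ} (h : f (x, 0) = 0) :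
    coeff 1 (leafSlope lam f x) = lam := by
  have : coeff 0 (yTaylor f x) = 0 := by rw [yTaylor, coeff_zero_taylorAtZero, h]
  have h2 : coeff (0 + 1) (leafSlope lam f x) = lam := by
    rw [leafSlope, coeff_succ_mul_X, map_add, this]; simp
  exact h2

/-- The derivative of `K` along the vector field `x ∂ₓ + (lam + f) y ∂_y` tangent to the
foliation. -/
noncomputable def transport (lam : ℂ) (f : ℂ × ℂ → ℂ) (K : ℂ × ℂ → ℂ) (q : ℂ × ℂ) : ℂ :=
  q.1 * partialX K q + (lam + f q) * q.2 * partialY K q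

theorem analyticAt_transport {lam : ℂ} {f K : ℂ × ℂ → ℂ} {q : ℂ × ℂ} (hf : AnalyticAt ℂ f q)
    (hK : AnalyticAt ℂ K q) : AnalyticAt ℂ (transport lam f K) q :=
  (analyticAt_fst.fun_mul hK.partialX).fun_add
    (((analyticAt_const.fun_add hf).fun_mul analyticAt_snd).fun_mul hK.partialY)

theorem transport_congr {lam : ℂ} {f K L : ℂ × ℂ → ℂ} {q : ℂ × ℂ} (h : K =ᶠ[𝓝 q] L) :
    transport lam f K =ᶠ[𝓝 q] transport lam f L := by
  filter_upwards [partialX_congr h, partialY_congr h] with p h1 h2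
  rw [transport, transport, h1, h2]

theorem yTaylor_transport {lam : ℂ} {f K : ℂ × ℂ → ℂ} {x : ℂ} (hf : AnalyticAt ℂ f (x, 0))
    (hK : AnalyticAt ℂ K (x, 0)) :
    yTaylor (transport lam f K) x =
      C x * yTaylor (partialX K) x + leafSlope lam f x * derivative ℂ (yTaylor K x) := by
  have h1 := analyticAt_slice hf
  have h2 := analyticAt_slice hK.partialX
  have h3 := analyticAt_slice hK.partialY
  have hid : AnalyticAt ℂ (fun y : ℂ => y) 0 := analyticAt_id
  have hc : ∀ a : ℂ, AnalyticAt ℂ (fun _ : ℂ => a) 0 := fun a => analyticAt_const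
  rw [← yTaylor_partialY hK, leafSlope]
  simp only [yTaylor, transport]
  rw [taylorAtZero_add ((hc x).fun_mul h2) ((((hc lam).fun_add h1).fun_mul hid).fun_mul h3),
    taylorAtZero_mul (hc x) h2, taylorAtZero_mul (((hc lam).fun_add h1).fun_mul hid) h3,
    taylorAtZero_mul ((hc lam).fun_add h1) hid, taylorAtZero_add (hc lam) h1, taylorAtZero_id,
    taylorAtZero_const, taylorAtZero_const]

theorem transport_eq_zero_of_isMinimalFirstIntegral {lam : ℂ} {f H : ℂ × ℂ → ℂ} {p : ℂ × ℂ}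
    (h : IsMinimalFirstIntegral (foliationForm lam f) p H) : transport lam f H =ᶠ[𝓝 p] 0 := by
  filter_upwards [h.2.2.2] with q hq
  have h1 := (hq (q.1, (lam + f q) * q.2)).2 (by simp [foliationForm]; ring)
  rw [fderiv_apply_eq_partial] at h1
  exact h1

theorem partialY_ne_zero_of_isMinimalFirstIntegral {lam : ℂ} {f H : ℂ × ℂ → ℂ} {x₀ : ℂ}
    (h : IsMinimalFirstIntegral (foliationForm lam f) (x₀, 0) H) : partialY H (x₀, 0) ≠ 0 := by
  intro h0
  apply h.2.2.1
  have h1 : partialX H (x₀, 0) = 0 := by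
    refine (h.2.2.2.self_of_nhds (1, 0)).2 ?_
    simp [foliationForm]
  ext <;> simp [fderiv_apply_eq_partial, h0, h1]

/-- The vanishing of the transport of a germ persists under analytic continuation. -/
theorem transport_eq_zero_of_continuation {lam : ℂ} {f : ℂ × ℂ → ℂ} {r : ℝ}
    (hf : AnalyticOnNhd ℂ f (disc r ×ˢ {0})) {x₀ : ℂ} (hx₀ : x₀ ∈ disc r)
    {K : ℝ → ℂ × ℂ → ℂ} (hK : IsAnalyticContinuation (loop x₀) K)
    (h0 : transport lam f (K 0) =ᶠ[𝓝 (loop x₀ 0)] 0) :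
    ∀ t ∈ Set.Icc (0 : ℝ) 1, transport lam f (K t) =ᶠ[𝓝 (loop x₀ t)] 0 := by
  have hcont : Continuous (loop x₀) := by unfold loop; fun_prop
  have hfa : ∀ t, AnalyticAt ℂ f (loop x₀ t) := fun t =>
    hf _ ⟨loop_mem_disc hx₀ t, by simp [loop]⟩
  intro t ht
  refine isPreconnected_Icc.induction₂' (fun s t => transport lam f (K s) =ᶠ[𝓝 (loop x₀ s)] 0 →
    transport lam f (K t) =ᶠ[𝓝 (loop x₀ t)] 0) ?_ (fun _ _ _ _ _ _ h h' => h' ∘ h)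
    (Set.left_mem_Icc.2 zero_le_one) ht h0
  intro s hs
  obtain ⟨hKs, hloc⟩ := hK s hs
  obtain ⟨δ, hδ, hball⟩ := Metric.eventually_nhds_iff_ball.1
    (analyticAt_transport (lam := lam) (hfa s) hKs).eventually_analyticAt
  have hmem : ∀ᶠ s' in 𝓝[Set.Icc (0 : ℝ) 1] s, loop x₀ s' ∈ Metric.ball (loop x₀ s) δ :=
    (hcont.continuousAt.eventually (Metric.ball_mem_nhds _ hδ)).filter_mono nhdsWithin_le_nhds
  filter_upwards [hloc, hmem] with s' hs' hmem'
  have hcongr := transport_congr (lam := lam) (f := f) hs'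
  have hz : ∀ p q, p ∈ Metric.ball (loop x₀ s) δ → q ∈ Metric.ball (loop x₀ s) δ →
      transport lam f (K s) =ᶠ[𝓝 p] 0 → transport lam f (K s) =ᶠ[𝓝 q] 0 := by
    intro p q hp hq h
    have h1 := AnalyticOnNhd.eqOn_zero_of_preconnected_of_eventuallyEq_zero (fun q hq => hball q hq)
      (convex_ball (loop x₀ s) δ).isPreconnected hp h
    filter_upwards [Metric.isOpen_ball.mem_nhds hq] with q' hq'
    exact h1 hq'
  have hself := Metric.mem_ball_self (x := loop x₀ s) hδ
  exact ⟨fun h => hcongr.trans (hz _ _ hself hmem' h),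
    fun h => hz _ _ hmem' hself (hcongr.symm.trans h)⟩

/-- `h t`, `t ∈ [0,1]`, are series in `y` without constant term that satisfy the transport
equation of first integrals of the foliation along the loop. -/
def IsFormalFirstIntegral (lam : ℂ) (f : ℂ × ℂ → ℂ) (x₀ : ℂ) (h : ℝ → ℂ⟦X⟧) : Prop :=
  ∀ t ∈ Set.Icc (0 : ℝ) 1, coeff 0 (h t) = 0 ∧
    HasCoeffDeriv h (C (-(2 * Real.pi * Complex.I)) * leafSlope lam f (loop x₀ t).1 *
      derivative ℂ (h t)) t

/-- Expanding the analytic continuation of a minimal first integral in powers of `y` along the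
loop gives a formal first integral, whose end value is the initial one followed by `φ`. -/
theorem exists_formalFirstIntegral {lam : ℂ} {r : ℝ} {f : ℂ × ℂ → ℂ} (hf : IsPerturbation r f)
    {x₀ : ℂ} (hx₀ : x₀ ∈ disc r) {H : ℂ × ℂ → ℂ} {φ : ℂ → ℂ}
    (hH : IsMinimalFirstIntegral (foliationForm lam f) (x₀, 0) H) (hφ : IsMonodromy x₀ H φ) :
    ∃ h : ℝ → ℂ⟦X⟧, IsFormalFirstIntegral lam f x₀ h ∧
      coeff 1 (h 0) = fderiv ℂ H (x₀, 0) (0, 1) ∧ coeff 1 (h 0) ≠ 0 ∧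
      h 1 = formalComp (taylorAtZero φ) (h 0) := by
  obtain ⟨hφd, K, hK, hK0, hK1⟩ := hφ
  have hfa : ∀ t, AnalyticAt ℂ f ((loop x₀ t).1, 0) := fun t =>
    hf.1 _ ⟨loop_mem_disc hx₀ t, rfl⟩
  have hT := transport_eq_zero_of_continuation (lam := lam) hf.1 hx₀ hK (by
    rw [loop_zero]
    exact (transport_congr hK0).trans (transport_eq_zero_of_isMinimalFirstIntegral hH))
  have h0 : yTaylor (K 0) (loop x₀ 0).1 = yTaylor H x₀ := by
    rw [loop_zero]; exact yTaylor_congr hK0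
  have hd : ∀ t ∈ Set.Icc (0 : ℝ) 1, HasCoeffDeriv (fun t => yTaylor (K t) (loop x₀ t).1)
      (C (-(2 * Real.pi * Complex.I)) * leafSlope lam f (loop x₀ t).1 *
        derivative ℂ (yTaylor (K t) (loop x₀ t).1)) t := by
    intro t ht n
    obtain ⟨hKt, hloc⟩ := hK t ht
    rw [loop_eq] at hKt
    have h1 := (hasDerivAt_coeff_yTaylor hKt n).comp t (hasDerivAt_loop x₀ t)
    have h2 : C (loop x₀ t).1 * yTaylor (partialX (K t)) (loop x₀ t).1 =
        -(leafSlope lam f (loop x₀ t).1 * derivative ℂ (yTaylor (K t) (loop x₀ t).1)) := by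
      rw [eq_neg_iff_add_eq_zero, ← yTaylor_transport (hfa t) hKt]
      have h3 := hT t ht
      rw [loop_eq] at h3
      rw [yTaylor_congr h3]
      simpa [yTaylor] using! taylorAtZero_const 0
    have h3 : coeff n (C (-(2 * Real.pi * Complex.I)) * leafSlope lam f (loop x₀ t).1 *
        derivative ℂ (yTaylor (K t) (loop x₀ t).1)) =
        coeff n (yTaylor (partialX (K t)) (loop x₀ t).1) *
          (2 * Real.pi * Complex.I * (loop x₀ t).1) := by
      have h4 := congrArg (coeff n) h2
      rw [coeff_C_mul, map_neg] at h4
      rw [mul_assoc, coeff_C_mul]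
      linear_combination (-2 * Real.pi * Complex.I) * h4
    rw [h3]
    refine h1.hasDerivWithinAt.congr_of_eventuallyEq_of_mem ?_ ht
    filter_upwards [hloc] with s hs
    rw [loop_eq] at hs
    simp only [Function.comp_apply]
    rw [yTaylor_congr hs]
  refine ⟨fun t => yTaylor (K t) (loop x₀ t).1, fun t ht => ⟨?_, hd t ht⟩, ?_, ?_, ?_⟩
  · have h1 := eq_exp_of_hasDerivWithinAt (c := 0) (fun s hs => by
      simpa [coeff_mul, leafSlope] using hd s hs 0) t ht
    have hz : coeff 0 (yTaylor H x₀) = 0 := by rw [yTaylor, coeff_zero_taylorAtZero, hH.2.1]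
    rw [h0, ← coeff_zero_eq_constantCoeff_apply, ← coeff_zero_eq_constantCoeff_apply, hz,
      zero_mul] at h1
    exact h1
  · simp only [h0]
    rw [yTaylor, coeff_one_taylorAtZero]
    exact (hasDerivAt_slice hH.1).deriv
  · simp only [h0]
    rw [yTaylor, coeff_one_taylorAtZero]
    rw [(hasDerivAt_slice hH.1).deriv]
    exact partialY_ne_zero_of_isMinimalFirstIntegral hH
  · simp only [h0, loop_one]
    rw [yTaylor_congr hK1, yTaylor, yTaylor,
      ← taylorAtZero_comp hφd.1 (analyticAt_slice hH.1) hH.2.1]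
    rfl

/-! ### Conjugacies of foliations induce conjugacies of holonomies -/

theorem transverseExpansion_A {lam : ℂ} {f : ℂ × ℂ → ℂ} {x : ℂ} (hf : AnalyticAt ℂ f (x, 0)) :
    (transverseExpansion (foliationForm lam f)).A x = -leafSlope lam f x := by
  have h1 := analyticAt_slice hf
  have hid : AnalyticAt ℂ (fun y : ℂ => y) 0 := analyticAt_id
  have hc : ∀ a : ℂ, AnalyticAt ℂ (fun _ : ℂ => a) 0 := fun a => analyticAt_const
  simp only [transverseExpansion, foliationForm, leafSlope, yTaylor]
  rw [← taylorAtZero_id, ← taylorAtZero_const, ← taylorAtZero_add (hc lam) h1,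
    ← taylorAtZero_mul ((hc lam).fun_add h1) hid, ← taylorAtZero_neg]
  simp

theorem transverseExpansion_B (lam : ℂ) (f : ℂ × ℂ → ℂ) (x : ℂ) :
    (transverseExpansion (foliationForm lam f)).B x = C x := by
  simp [transverseExpansion, foliationForm, taylorAtZero_const]

/-- The conjugacy equation: `Y` maps solutions of `x dy/dx = leafSlope₁` to solutions of
`x dy/dx = leafSlope₂`. -/
theorem wedge_eq_zero_iff {lam : ℂ} {f₁ f₂ : ℂ × ℂ → ℂ} {x : ℂ} (hf₁ : AnalyticAt ℂ f₁ (x, 0))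
    (hf₂ : AnalyticAt ℂ f₂ (x, 0)) {Y : ℂ → ℂ⟦X⟧} (hY : coeff 0 (Y x) = 0) :
    ((transverseExpansion (foliationForm lam f₂)).pullback Y).wedge
      (transverseExpansion (foliationForm lam f₁)) x = 0 ↔ x = 0 ∨
    C x * dX Y x + leafSlope lam f₁ x * dY Y x = formalComp (leafSlope lam f₂ x) (Y x) := by
  simp only [FormalForm.wedge, FormalForm.pullback, transverseExpansion_A hf₁,
    transverseExpansion_A hf₂, transverseExpansion_B, formalComp_C, formalComp_neg _ hY]
  have h1 : (-formalComp (leafSlope lam f₂ x) (Y x) + C x * dX Y x) * C x -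
      C x * dY Y x * -leafSlope lam f₁ x = C x * ((C x * dX Y x + leafSlope lam f₁ x * dY Y x) -
        formalComp (leafSlope lam f₂ x) (Y x)) := by ring
  rw [h1, mul_eq_zero, sub_eq_zero, map_eq_zero_iff _ C_injective]

theorem coeff_zero_loopSlope (lam : ℂ) (f : ℂ × ℂ → ℂ) (c x : ℂ) :
    coeff 0 (C c * leafSlope lam f x) = 0 := by
  rw [coeff_C_mul, coeff_zero_leafSlope, mul_zero]

theorem coeff_one_loopSlope {lam : ℂ} {f : ℂ × ℂ → ℂ} {x : ℂ} (c : ℂ) (h : f (x, 0) = 0) :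
    coeff 1 (C c * leafSlope lam f x) = c * lam := by
  rw [coeff_C_mul, coeff_one_leafSlope h]

theorem IsFormalFirstIntegral.ext {lam : ℂ} {r : ℝ} {f : ℂ × ℂ → ℂ} (hf : IsPerturbation r f)
    {x₀ : ℂ} (hx₀ : x₀ ∈ disc r) {h k : ℝ → ℂ⟦X⟧} (hh : IsFormalFirstIntegral lam f x₀ h)
    (hk : IsFormalFirstIntegral lam f x₀ k) (h0 : h 0 = k 0) :
    ∀ t ∈ Set.Icc (0 : ℝ) 1, h t = k t :=
  transport_unique' (fun _ _ => coeff_zero_loopSlope _ _ _ _)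
    (fun t _ => coeff_one_loopSlope _ (hf.2 _ (loop_mem_disc hx₀ t)))
    (fun t ht => (hh t ht).2) (fun t ht => (hk t ht).2) h0

theorem IsFormalFirstIntegral.const_comp {lam : ℂ} {f : ℂ × ℂ → ℂ} {x₀ : ℂ} {h : ℝ → ℂ⟦X⟧}
    (hh : IsFormalFirstIntegral lam f x₀ h) {ψ : ℂ⟦X⟧} (hψ : coeff 0 ψ = 0) :
    IsFormalFirstIntegral lam f x₀ (fun t => formalComp ψ (h t)) := fun t ht =>
  ⟨coeff_zero_formalComp hψ (hh t ht).1, HasCoeffDeriv.const_comp ψ ht (fun s hs => (hh s hs).1)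
    (G := fun t => C (-(2 * Real.pi * Complex.I)) * leafSlope lam f (loop x₀ t).1) (hh t ht).2⟩

theorem hasCoeffDeriv_comp_loop {r : ℝ} {Y : ℂ → ℂ⟦X⟧} (hY : IsTransverselyFormal (disc r) Y)
    {x₀ : ℂ} (hx₀ : x₀ ∈ disc r) (t : ℝ) :
    HasCoeffDeriv (fun t => Y (loop x₀ t).1)
      (C (2 * Real.pi * Complex.I) * (C (loop x₀ t).1 * dX Y (loop x₀ t).1)) t := by
  intro n
  have h1 := (hY n _ (loop_mem_disc hx₀ t)).differentiableAt.hasDerivAt.comp t (hasDerivAt_loop x₀ t)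
  refine h1.hasDerivWithinAt.congr_deriv ?_
  rw [coeff_C_mul, coeff_C_mul, dX, coeff_mk]
  ring

/-- A conjugacy `Y` transforms first integrals of the second foliation into first integrals of the
first one. -/
theorem IsFormalFirstIntegral.comp_conjugacy {lam : ℂ} {r : ℝ} {f₁ f₂ : ℂ × ℂ → ℂ}
    (hf₁ : IsPerturbation r f₁) (hf₂ : IsPerturbation r f₂) {x₀ : ℂ} (hx₀ : x₀ ∈ disc r)
    (hx₀' : x₀ ≠ 0) {c : ℂ} {Y : ℂ → ℂ⟦X⟧} (hY : IsFiberedFormalDiffeo (disc r) c Y)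
    (hconj : ∀ x ∈ disc r, ((transverseExpansion (foliationForm lam f₂)).pullback Y).wedge
      (transverseExpansion (foliationForm lam f₁)) x = 0)
    {h : ℝ → ℂ⟦X⟧} (hh : IsFormalFirstIntegral lam f₂ x₀ h) :
    IsFormalFirstIntegral lam f₁ x₀ (fun t => formalComp (h t) (Y (loop x₀ t).1)) := by
  intro t ht
  have hx := loop_mem_disc hx₀ t
  have hY0 : ∀ t, coeff 0 (Y (loop x₀ t).1) = 0 := fun t => (hY.2 _ (loop_mem_disc hx₀ t)).1
  refine ⟨coeff_zero_formalComp (hh t ht).1 (hY0 t), ?_⟩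
  have h1 := HasCoeffDeriv.formalComp ht (fun s _ => hY0 s) (hh t ht).2
    (hasCoeffDeriv_comp_loop hY.1 hx₀ t)
  have h2 := ((wedge_eq_zero_iff (x := (loop x₀ t).1) (hf₁.1 _ ⟨hx, rfl⟩) (hf₂.1 _ ⟨hx, rfl⟩) (hY0 t)).1
    (hconj _ hx)).resolve_left (loop_ne_zero hx₀' t)
  convert h1 using 1
  rw [derivative_formalComp _ (hY0 t), formalComp_mul _ _ (hY0 t), formalComp_C_mul _ _ (hY0 t),
    ← h2, map_neg]
  simp only [dY]
  ring

theorem conjugacy_of_foliationConjugacy {lam : ℂ} {r : ℝ} {f₁ f₂ : ℂ × ℂ → ℂ}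
    (hf₁ : IsPerturbation r f₁) (hf₂ : IsPerturbation r f₂) {x₀ : ℂ} (hx₀ : x₀ ∈ disc r)
    (hx₀' : x₀ ≠ 0) {c : ℂ}
    (hc : FormalFoliationConjugacy (disc r) c (foliationForm lam f₁) (foliationForm lam f₂))
    {φ₁ φ₂ : ℂ → ℂ} (hφ₁ : IsDiffGerm φ₁) {h₁ h₂ : ℝ → ℂ⟦X⟧}
    (hh₁ : IsFormalFirstIntegral lam f₁ x₀ h₁)
    (hh₂ : IsFormalFirstIntegral lam f₂ x₀ h₂) (hl₁ : coeff 1 (h₁ 0) ≠ 0)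
    (hm₁ : h₁ 1 = formalComp (taylorAtZero φ₁) (h₁ 0))
    (hm₂ : h₂ 1 = formalComp (taylorAtZero φ₂) (h₂ 0)) :
    ∃ ψ, IsFormalConjugacy (coeff 1 (h₂ 0) * c / coeff 1 (h₁ 0)) ψ φ₁ φ₂ := by
  obtain ⟨Y, hY, hconj⟩ := hc
  have hU := hh₂.comp_conjugacy hf₁ hf₂ hx₀ hx₀' hY hconj
  obtain ⟨Z, hZ⟩ : ∃ Z, Z = Y x₀ := ⟨_, rfl⟩
  have hZ0 : coeff 0 Z = 0 := hZ ▸ (hY.2 _ hx₀).1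
  have hZ1 : coeff 1 Z = c := hZ ▸ (hY.2 _ hx₀).2
  have i0 : (0 : ℝ) ∈ Set.Icc (0 : ℝ) 1 := by simp
  have i1 : (1 : ℝ) ∈ Set.Icc (0 : ℝ) 1 := by simp
  have hz₁ := (hh₁ 0 i0).1
  have hz₂ := (hh₂ 0 i0).1
  have hT : ∀ φ, IsDiffGerm φ → coeff 0 (taylorAtZero φ) = 0 := fun φ hφ => by
    rw [coeff_zero_taylorAtZero, hφ.2.1]
  obtain ⟨L, hL0, hL1, hL2⟩ := exists_formal_inverse hz₁ hl₁
  set ψ := formalComp (formalComp (h₂ 0) Z) L with hψ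
  have hψh : formalComp ψ (h₁ 0) = formalComp (h₂ 0) Z := by
    rw [hψ, formalComp_assoc _ hL0 hz₁, hL2, formalComp_X_right]
  have hψ0 : coeff 0 ψ = 0 := coeff_zero_formalComp (coeff_zero_formalComp hz₂ hZ0) hL0
  refine ⟨ψ, hψ0, ?_, ?_⟩
  · have h3 := congrArg (coeff 1) hψh
    rw [coeff_one_formalComp hz₁, coeff_one_formalComp hZ0, hZ1] at h3
    rw [← h3]
    field_simp
  · have h4 := (hh₁.const_comp hψ0).ext hf₁ hx₀ hU (by simp only [loop_zero, ← hZ, hψh]) 1 i1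
    simp only [loop_one, ← hZ, hm₁, hm₂] at h4
    apply formalComp_right_cancel hz₁ hl₁
    rw [formalComp_assoc _ (hT _ hφ₁) hz₁, h4, formalComp_assoc _ hz₂ hZ0,
      formalComp_assoc _ hψ0 hz₁, hψh]

/-! ### Coefficientwise construction of conjugacies on the disc -/

/-- Dependent choice: a sequence all of whose terms satisfy a condition on the previous ones. -/
theorem exists_sequence_of_step {A : Type*} [Inhabited A] (R : ℕ → (ℕ → A) → Prop)
    (hR : ∀ n y y', (∀ k ≤ n, y k = y' k) → R n y → R n y')
    (step : ∀ n y, (∀ k < n, R k y) → ∃ a, R n (Function.update y n a)) : ∃ y, ∀ n, R n y := by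
  classical
  have step' : ∀ n y, ∃ a, (∀ k < n, R k y) → R n (Function.update y n a) := by
    intro n y
    by_cases h : ∀ k < n, R k y
    · obtain ⟨a, ha⟩ := step n y h
      exact ⟨a, fun _ => ha⟩
    · exact ⟨default, fun h' => absurd h' h⟩
  choose g hg using step'
  let s : ℕ → ℕ → A := fun n => Nat.rec (fun _ => default) (fun n y => Function.update y n (g n y)) n
  have hs : ∀ n, s (n + 1) = Function.update (s n) n (g n (s n)) := fun n => rfl
  have hstable : ∀ m k, k < m → s m k = s (k + 1) k := by
    intro m
    induction m with
    | zero => intro k hk; omega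
    | succ m ih =>
      intro k hk
      rcases Nat.lt_succ_iff_lt_or_eq.1 hk with h | rfl
      · rw [hs, Function.update_of_ne (by omega), ih k h]
      · rfl
  have hgood : ∀ n, R n (s (n + 1)) := by
    intro n
    induction n using Nat.strong_induction_on with
    | _ n ih =>
      rw [hs]
      refine hg n (s n) fun k hk => hR k _ _ (fun j hj => ?_) (ih k hk)
      rw [hstable (k + 1) j (by omega), hstable n j (by omega)]
  exact ⟨fun n => s (n + 1) n, fun n => hR n _ _ (fun k hk => hstable (n + 1) k (by omega)) (hgood n)⟩

/-- The nonlinear part of the conjugacy equation. -/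
noncomputable def nonlinearPart (f₁ f₂ : ℂ × ℂ → ℂ) (x : ℂ) (Z : ℂ⟦X⟧) : ℂ⟦X⟧ :=
  formalComp (yTaylor f₂ x * X) Z - yTaylor f₁ x * X * derivative ℂ Z

theorem coeff_zero_yTaylor_mul_X (f : ℂ × ℂ → ℂ) (x : ℂ) : coeff 0 (yTaylor f x * X) = 0 := by
  simp

theorem coeff_one_yTaylor_mul_X {f : ℂ × ℂ → ℂ} {x : ℂ} (h : f (x, 0) = 0) :
    coeff 1 (yTaylor f x * X) = 0 := by
  have h2 : coeff (0 + 1) (yTaylor f x * X) = 0 := by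
    rw [coeff_succ_mul_X, yTaylor, coeff_zero_taylorAtZero, h]
  exact h2

theorem coeff_nonlinearPart_congr {f₁ f₂ : ℂ × ℂ → ℂ} {x : ℂ} (hf₁ : f₁ (x, 0) = 0)
    (hf₂ : f₂ (x, 0) = 0) {Z Z' : ℂ⟦X⟧} (hZ : coeff 0 Z = 0) (hZ' : coeff 0 Z' = 0) {n : ℕ}
    (h : ∀ k < n, coeff k Z = coeff k Z') :
    coeff n (nonlinearPart f₁ f₂ x Z) = coeff n (nonlinearPart f₁ f₂ x Z') := by
  rw [nonlinearPart, nonlinearPart, map_sub, map_sub,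
    coeff_formalComp_congr (coeff_one_yTaylor_mul_X hf₂) hZ hZ' h,
    coeff_mul_derivative_congr (coeff_zero_yTaylor_mul_X f₁ x) (coeff_one_yTaylor_mul_X hf₁) h]

theorem nonlinearPart_zero (f₁ f₂ : ℂ × ℂ → ℂ) (x : ℂ) (n : ℕ) (hn : n < 2)
    (hf₁ : f₁ (x, 0) = 0) (hf₂ : f₂ (x, 0) = 0) {Z : ℂ⟦X⟧} (hZ : coeff 0 Z = 0) :
    coeff n (nonlinearPart f₁ f₂ x Z) = 0 := by
  have h0 : coeff 0 (0 : ℂ⟦X⟧) = 0 := map_zero _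
  rw [coeff_nonlinearPart_congr hf₁ hf₂ hZ h0 (fun k hk => by
    obtain rfl : k = 0 := by omega
    rw [hZ, h0]), nonlinearPart, map_zero, mul_zero, sub_zero, coeff_formalComp h0 (Nat.lt_succ_self n)]
  refine Finset.sum_eq_zero fun j _ => ?_
  rcases j with _ | j
  · simp
  · simp

theorem leafSlope_eq (lam : ℂ) (f : ℂ × ℂ → ℂ) (x : ℂ) :
    leafSlope lam f x = C lam * X + yTaylor f x * X := by rw [leafSlope, add_mul]

theorem coeff_X_mul_derivative (Z : ℂ⟦X⟧) (n : ℕ) : coeff n (X * derivative ℂ Z) = n * coeff n Z := by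
  rcases n with _ | n
  · simp
  · rw [coeff_succ_X_mul, coeff_derivative]; push_cast; ring

/-- The linear part of the conjugacy equation is diagonal. -/
theorem coeff_leafSlope_sub (lam : ℂ) (f₁ f₂ : ℂ × ℂ → ℂ) (x : ℂ) {Z : ℂ⟦X⟧} (hZ : coeff 0 Z = 0)
    (n : ℕ) : coeff n (formalComp (leafSlope lam f₂ x) Z - leafSlope lam f₁ x * derivative ℂ Z) =
      coeff n (nonlinearPart f₁ f₂ x Z) - ((n : ℂ) - 1) * lam * coeff n Z := by
  have h : formalComp (leafSlope lam f₂ x) Z - leafSlope lam f₁ x * derivative ℂ Z =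
      nonlinearPart f₁ f₂ x Z + C lam * Z - C lam * (X * derivative ℂ Z) := by
    rw [leafSlope_eq, leafSlope_eq, formalComp_add _ _ hZ, formalComp_C_mul _ _ hZ, formalComp_X hZ,
      nonlinearPart]
    ring
  rw [h, map_sub, map_add, coeff_C_mul, coeff_C_mul, coeff_X_mul_derivative]
  ring

theorem IsTransverselyFormal.mul {D : Set ℂ} {A B : ℂ → ℂ⟦X⟧} (hA : IsTransverselyFormal D A)
    (hB : IsTransverselyFormal D B) : IsTransverselyFormal D (fun x => A x * B x) := by
  intro n
  simp only [coeff_mul]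
  exact Finset.analyticOnNhd_fun_sum _ fun p _ => (hA p.1).mul (hB p.2)

theorem isTransverselyFormal_const (D : Set ℂ) (A : ℂ⟦X⟧) : IsTransverselyFormal D (fun _ => A) :=
  fun _ => analyticOnNhd_const

theorem IsTransverselyFormal.pow {D : Set ℂ} {A : ℂ → ℂ⟦X⟧} (hA : IsTransverselyFormal D A)
    (j : ℕ) : IsTransverselyFormal D (fun x => A x ^ j) := by
  induction j with
  | zero => simpa using isTransverselyFormal_const D 1
  | succ j ih => simpa only [pow_succ] using ih.mul hA

theorem IsTransverselyFormal.formalComp {D : Set ℂ} {A B : ℂ → ℂ⟦X⟧}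
    (hA : IsTransverselyFormal D A) (hB : IsTransverselyFormal D B)
    (hB0 : ∀ x, coeff 0 (B x) = 0) : IsTransverselyFormal D (fun x => formalComp (A x) (B x)) := by
  intro n
  simp only [coeff_formalComp (hB0 _) (Nat.lt_succ_self n)]
  exact Finset.analyticOnNhd_fun_sum _ fun j _ => (hA j).mul (hB.pow j n)

theorem IsTransverselyFormal.derivative {D : Set ℂ} {A : ℂ → ℂ⟦X⟧}
    (hA : IsTransverselyFormal D A) : IsTransverselyFormal D (fun x => derivative ℂ (A x)) := by
  intro n
  simp only [coeff_derivative]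
  exact (hA (n + 1)).mul analyticOnNhd_const

theorem IsPerturbation.isTransverselyFormal {r : ℝ} {f : ℂ × ℂ → ℂ} (hf : IsPerturbation r f) :
    IsTransverselyFormal (disc r) (fun x => yTaylor f x * X) :=
  IsTransverselyFormal.mul (fun n _ hx => analyticAt_coeff_yTaylor (hf.1 _ ⟨hx, rfl⟩) n)
    (isTransverselyFormal_const _ X)

theorem analyticOnNhd_coeff_nonlinearPart {r : ℝ} {f₁ f₂ : ℂ × ℂ → ℂ} (hf₁ : IsPerturbation r f₁)
    (hf₂ : IsPerturbation r f₂) {Z : ℂ → ℂ⟦X⟧} (hZ : IsTransverselyFormal (disc r) Z)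
    (hZ0 : ∀ x, coeff 0 (Z x) = 0) (n : ℕ) :
    AnalyticOnNhd ℂ (fun x => coeff n (nonlinearPart f₁ f₂ x (Z x))) (disc r) := by
  simp only [nonlinearPart, map_sub]
  exact (hf₂.isTransverselyFormal.formalComp hZ hZ0 n).sub
    (hf₁.isTransverselyFormal.mul hZ.derivative n)

/-- A conjugacy can be constructed coefficient by coefficient: the coefficient of degree `n` solves
an Euler equation whose right-hand side `P` depends on the lower ones only. The predicate `Q` is a
side condition used to select the solution. -/
theorem foliationConjugacy_of_step {lam : ℂ} {r : ℝ} {f₁ f₂ : ℂ × ℂ → ℂ}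
    (hf₁ : IsPerturbation r f₁) (hf₂ : IsPerturbation r f₂) (c : ℂ) (Q : ℕ → (ℂ → ℂ) → Prop)
    (hQ0 : Q 0 fun _ => 0) (hQ1 : Q 1 fun _ => c)
    (hstep : ∀ n, 2 ≤ n → ∀ Z : ℂ → ℂ⟦X⟧, (∀ x, coeff 0 (Z x) = 0) →
      (∀ k < n, Q k fun x => coeff k (Z x)) →
      AnalyticOnNhd ℂ (fun x => coeff n (nonlinearPart f₁ f₂ x (Z x))) (disc r) →
      ∃ a : ℂ → ℂ, AnalyticOnNhd ℂ a (disc r) ∧ (∀ x ∈ disc r,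
        x * deriv a x + ((n : ℂ) - 1) * lam * a x = coeff n (nonlinearPart f₁ f₂ x (Z x))) ∧ Q n a) :
    FormalFoliationConjugacy (disc r) c (foliationForm lam f₁) (foliationForm lam f₂) := by
  set tr : ℕ → (ℕ → ℂ → ℂ) → ℂ → ℂ⟦X⟧ := fun n y x =>
    PowerSeries.mk fun k => if k < n then y k x else 0 with htr
  obtain ⟨y, hy⟩ := exists_sequence_of_step (A := ℂ → ℂ) (fun n y =>
      AnalyticOnNhd ℂ (y n) (disc r) ∧ Q n (y n) ∧ (n = 0 → ∀ x, y n x = 0) ∧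
      (n = 1 → ∀ x, y n x = c) ∧ ∀ x ∈ disc r, x * deriv (y n) x + ((n : ℂ) - 1) * lam * y n x =
        coeff n (nonlinearPart f₁ f₂ x (tr n y x)))
    (by
      intro n y y' h
      have h1 : tr n y = tr n y' := by
        funext x
        ext k
        simp only [htr, coeff_mk]
        split_ifs with hk
        · rw [h k hk.le]
        · rfl
      rw [h n le_rfl, h1]
      exact id)
    (by
      intro n y hy
      have h1 : ∀ a, tr n (Function.update y n a) = tr n y := by
        intro a
        funext x
        ext k
        simp only [htr, coeff_mk]
        split_ifs with hk
        · rw [Function.update_of_ne (by omega)]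
        · rfl
      have h0 : ∀ x, coeff 0 (tr n y x) = 0 := by
        intro x
        simp only [htr, coeff_mk]
        split_ifs with hk
        · exact (hy 0 hk).2.2.1 rfl x
        · rfl
      simp only [h1, Function.update_self]
      match n with
      | 0 =>
        refine ⟨fun _ => 0, analyticOnNhd_const, hQ0, fun _ _ => rfl, by simp, fun x hx => ?_⟩
        rw [nonlinearPart_zero _ _ _ _ (by omega) (hf₁.2 x hx) (hf₂.2 x hx) (h0 x)]
        simp
      | 1 =>
        refine ⟨fun _ => c, analyticOnNhd_const, hQ1, by simp, fun _ _ => rfl, fun x hx => ?_⟩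
        rw [nonlinearPart_zero _ _ _ _ (by omega) (hf₁.2 x hx) (hf₂.2 x hx) (h0 x)]
        simp
      | n + 2 =>
        have h2 : ∀ k < n + 2, (fun x => coeff k (tr (n + 2) y x)) = y k := by
          intro k hk
          funext x
          simp only [htr, coeff_mk, if_pos hk]
        have h3 : IsTransverselyFormal (disc r) (tr (n + 2) y) := by
          intro k
          by_cases hk : k < n + 2
          · rw [h2 k hk]; exact (hy k hk).1
          · simp only [htr, coeff_mk, if_neg hk]
            exact analyticOnNhd_const
        obtain ⟨a, ha, hode, hQ⟩ := hstep (n + 2) (by omega) (tr (n + 2) y) h0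
          (fun k hk => by rw [h2 k hk]; exact (hy k hk).2.1)
          (analyticOnNhd_coeff_nonlinearPart hf₁ hf₂ h3 h0 _)
        exact ⟨a, ha, hQ, by omega, by omega, hode⟩)
  set Y : ℂ → ℂ⟦X⟧ := fun x => PowerSeries.mk fun k => y k x with hYdef
  have hYc : ∀ n x, coeff n (Y x) = y n x := fun n x => coeff_mk _ _
  have hY0 : ∀ x, coeff 0 (Y x) = 0 := fun x => by rw [hYc]; exact (hy 0).2.2.1 rfl x
  refine ⟨Y, ⟨fun n => ?_, fun x _ => ⟨hY0 x, ?_⟩⟩, fun x hx => ?_⟩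
  · simp only [hYc]; exact (hy n).1
  · rw [hYc]; exact (hy 1).2.2.2.1 rfl x
  · refine (wedge_eq_zero_iff (hf₁.1 _ ⟨hx, rfl⟩) (hf₂.1 _ ⟨hx, rfl⟩) (hY0 x)).2 (Or.inr ?_)
    rw [← eq_sub_iff_add_eq]
    ext n
    rw [dY, coeff_leafSlope_sub _ _ _ _ (hY0 x), coeff_C_mul, dX, coeff_mk]
    simp only [hYc]
    rw [coeff_nonlinearPart_congr (hf₁.2 x hx) (hf₂.2 x hx) (hY0 x) (Z' := tr n y x) ?_ ?_,
      ← (hy n).2.2.2.2 x hx]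
    · ring
    · simp only [htr, coeff_mk]
      split_ifs
      · exact (hy 0).2.2.1 rfl x
      · rfl
    · intro k hk
      simp only [htr, coeff_mk, hYc, if_pos hk]

/-- In the absence of resonances, a conjugacy tangent to the identity always exists. -/
theorem foliationConjugacy_of_not_resonant {lam : ℂ} {r : ℝ} {f₁ f₂ : ℂ × ℂ → ℂ}
    (hf₁ : IsPerturbation r f₁) (hf₂ : IsPerturbation r f₂)
    (hlam : ∀ n : ℕ, 2 ≤ n → ∀ k : ℕ, (k : ℂ) + ((n : ℂ) - 1) * lam ≠ 0) :
    FormalFoliationConjugacy (disc r) 1 (foliationForm lam f₁) (foliationForm lam f₂) := by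
  refine foliationConjugacy_of_step hf₁ hf₂ 1 (fun _ _ => True) trivial trivial ?_
  intro n hn Z _ _ hP
  obtain ⟨a, ha, hode⟩ := exists_euler_solution_of_not_resonant hP (hlam n hn)
  exact ⟨a, ha, hode, trivial⟩

/-- If there is a resonance then `lam` is a nonpositive rational number, so that no multiple of it
is a positive integer. -/
theorem mul_ne_natCast_of_resonant {lam : ℂ} {n k : ℕ} (hn : 2 ≤ n)
    (h : (k : ℂ) + ((n : ℂ) - 1) * lam = 0) (j : ℕ) {m : ℕ} (hm : 0 < m) :
    (j : ℂ) * lam ≠ m := by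
  intro h'
  obtain ⟨n, rfl⟩ : ∃ n', n = n' + 2 := ⟨n - 2, by omega⟩
  have h1 : (((j * k + (n + 1) * m : ℕ)) : ℂ) = 0 := by
    push_cast at h ⊢
    linear_combination (j : ℂ) * h - ((n : ℂ) + 1) * h'
  have h2 : j * k + (n + 1) * m = 0 := by exact_mod_cast h1
  have : 0 < (n + 1) * m := by positivity
  omega

/-! ### Conjugacies of holonomies induce conjugacies of foliations -/

theorem coeff_pow_self {B : ℂ⟦X⟧} (hB : coeff 0 B = 0) (n : ℕ) :
    coeff n (B ^ n) = (coeff 1 B) ^ n := by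
  obtain ⟨D, rfl⟩ : (X : ℂ⟦X⟧) ∣ B := X_dvd_iff.2 (by simpa using hB)
  have h1 : coeff 1 (X * D) = coeff 0 D := coeff_succ_X_mul 0 D
  have h2 := coeff_X_pow_mul (D ^ n) n 0
  rw [zero_add] at h2
  rw [h1, mul_pow, h2]
  simp

/-- The compositional inverse of a differentiable family of series is differentiable. -/
theorem hasCoeffDeriv_inverse {h L : ℝ → ℂ⟦X⟧} {h' : ℝ → ℂ⟦X⟧}
    (hh : ∀ t ∈ Set.Icc (0 : ℝ) 1, HasCoeffDeriv h (h' t) t)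
    (h0 : ∀ t ∈ Set.Icc (0 : ℝ) 1, coeff 0 (h t) = 0)
    (h1 : ∀ t ∈ Set.Icc (0 : ℝ) 1, coeff 1 (h t) ≠ 0)
    (hL : ∀ t ∈ Set.Icc (0 : ℝ) 1, formalComp (L t) (h t) = X) :
    ∃ L' : ℝ → ℂ⟦X⟧, ∀ t ∈ Set.Icc (0 : ℝ) 1, HasCoeffDeriv L (L' t) t := by
  have key : ∀ n, DifferentiableOn ℝ (fun t => coeff n (L t)) (Set.Icc 0 1) := by
    intro n
    induction n using Nat.strong_induction_on with
    | _ n ih =>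
      have h2 : ∀ t ∈ Set.Icc (0 : ℝ) 1, coeff n (L t) = (coeff n (X : ℂ⟦X⟧) -
          ∑ j ∈ Finset.range n, coeff j (L t) * coeff n (h t ^ j)) * (coeff 1 (h t) ^ n)⁻¹ := by
        intro t ht
        have h3 := congrArg (coeff n) (hL t ht)
        rw [coeff_formalComp (h0 t ht) (Nat.lt_succ_self n), Finset.sum_range_succ,
          coeff_pow_self (h0 t ht)] at h3
        rw [← h3, add_sub_cancel_left, mul_assoc, mul_inv_cancel₀ (pow_ne_zero _ (h1 t ht)), mul_one]
      have hdiff : ∀ j k, DifferentiableOn ℝ (fun t => coeff k (h t ^ j)) (Set.Icc 0 1) :=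
        fun j k t ht => ((hh t ht).pow j k).differentiableWithinAt
      refine DifferentiableOn.congr ?_ h2
      refine DifferentiableOn.mul (DifferentiableOn.sub (differentiableOn_const _)
        (DifferentiableOn.fun_sum fun j hj => (ih j (Finset.mem_range.1 hj)).mul (hdiff j n))) ?_
      refine DifferentiableOn.inv (DifferentiableOn.pow ?_ n) fun t ht => pow_ne_zero _ (h1 t ht)
      simpa using hdiff 1 1
  refine ⟨fun t => PowerSeries.mk fun n => derivWithin (fun t => coeff n (L t)) (Set.Icc 0 1) t,
    fun t ht n => ?_⟩
  rw [coeff_mk]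
  exact (key n t ht).hasDerivWithinAt

theorem IsFormalFirstIntegral.coeff_one {lam : ℂ} {r : ℝ} {f : ℂ × ℂ → ℂ} (hf : IsPerturbation r f)
    {x₀ : ℂ} (hx₀ : x₀ ∈ disc r) {h : ℝ → ℂ⟦X⟧} (hh : IsFormalFirstIntegral lam f x₀ h) :
    ∀ t ∈ Set.Icc (0 : ℝ) 1, coeff 1 (h t) =
      coeff 1 (h 0) * Complex.exp (-(2 * Real.pi * Complex.I) * lam * t) := by
  refine eq_exp_of_hasDerivWithinAt (v := fun t => coeff 1 (h t)) fun t ht => ?_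
  refine ((hh t ht).2 1).congr_deriv ?_
  have h0 := coeff_zero_loopSlope lam f (-(2 * Real.pi * Complex.I)) (loop x₀ t).1
  rw [coeff_zero_eq_constantCoeff_apply] at h0
  rw [coeff_one_mul, h0, mul_zero, add_zero,
    coeff_one_loopSlope _ (hf.2 _ (loop_mem_disc hx₀ t)), ← coeff_zero_eq_constantCoeff_apply,
    coeff_derivative]
  simp

/-- A formal conjugacy `ψ` of the holonomies extends along the loop to a periodic solution of the
conjugacy equation, `h₂⁻¹ ∘ ψ ∘ h₁`. -/
theorem exists_conjugacy_along_loop {lam : ℂ} {r : ℝ} {f₁ f₂ : ℂ × ℂ → ℂ}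
    (hf₁ : IsPerturbation r f₁) (hf₂ : IsPerturbation r f₂) {x₀ : ℂ} (hx₀ : x₀ ∈ disc r)
    {φ₁ φ₂ : ℂ → ℂ} (hφ₁ : IsDiffGerm φ₁) (hφ₂ : IsDiffGerm φ₂) {h₁ h₂ : ℝ → ℂ⟦X⟧}
    (hh₁ : IsFormalFirstIntegral lam f₁ x₀ h₁)
    (hh₂ : IsFormalFirstIntegral lam f₂ x₀ h₂) (hl₂ : coeff 1 (h₂ 0) ≠ 0)
    (hm₁ : h₁ 1 = formalComp (taylorAtZero φ₁) (h₁ 0))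
    (hm₂ : h₂ 1 = formalComp (taylorAtZero φ₂) (h₂ 0))
    {c : ℂ} {ψ : ℂ⟦X⟧} (hψ : IsFormalConjugacy c ψ φ₁ φ₂) :
    ∃ Y : ℝ → ℂ⟦X⟧, Y 1 = Y 0 ∧ ∀ t ∈ Set.Icc (0 : ℝ) 1, coeff 0 (Y t) = 0 ∧
      coeff 1 (Y t) = coeff 1 (h₁ 0) * c / coeff 1 (h₂ 0) ∧
      HasCoeffDeriv Y (C (2 * Real.pi * Complex.I) * (formalComp (leafSlope lam f₂ (loop x₀ t).1) (Y t) -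
        leafSlope lam f₁ (loop x₀ t).1 * derivative ℂ (Y t))) t := by
  obtain ⟨hψ0, hψ1, hψ⟩ := hψ
  have i0 : (0 : ℝ) ∈ Set.Icc (0 : ℝ) 1 := by simp
  have i1 : (1 : ℝ) ∈ Set.Icc (0 : ℝ) 1 := by simp
  have hT : ∀ φ, IsDiffGerm φ → coeff 0 (taylorAtZero φ) = 0 := fun φ hφ => by
    rw [coeff_zero_taylorAtZero, hφ.2.1]
  have hl₂' : ∀ t ∈ Set.Icc (0 : ℝ) 1, coeff 1 (h₂ t) ≠ 0 := fun t ht => by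
    rw [hh₂.coeff_one hf₂ hx₀ t ht]
    exact mul_ne_zero hl₂ (Complex.exp_ne_zero _)
  have hinv : ∀ t, ∃ L : ℂ⟦X⟧, t ∈ Set.Icc (0 : ℝ) 1 →
      coeff 0 L = 0 ∧ formalComp (h₂ t) L = X ∧ formalComp L (h₂ t) = X := by
    intro t
    by_cases ht : t ∈ Set.Icc (0 : ℝ) 1
    · obtain ⟨L, hL⟩ := exists_formal_inverse (hh₂ t ht).1 (hl₂' t ht)
      exact ⟨L, fun _ => hL⟩
    · exact ⟨0, fun h => absurd h ht⟩
  choose L hL using hinv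
  obtain ⟨L', hL'⟩ := hasCoeffDeriv_inverse (fun t ht => (hh₂ t ht).2) (fun t ht => (hh₂ t ht).1)
    hl₂' (fun t ht => (hL t ht).2.2)
  have hW := hh₁.const_comp hψ0
  set Y : ℝ → ℂ⟦X⟧ := fun t => formalComp (L t) (formalComp ψ (h₁ t)) with hY
  have hY0 : ∀ t ∈ Set.Icc (0 : ℝ) 1, coeff 0 (Y t) = 0 := fun t ht =>
    coeff_zero_formalComp (hL t ht).1 (hW t ht).1
  have hYeq : ∀ t ∈ Set.Icc (0 : ℝ) 1, formalComp (h₂ t) (Y t) = formalComp ψ (h₁ t) := by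
    intro t ht
    rw [hY, ← formalComp_assoc _ (hL t ht).1 (hW t ht).1, (hL t ht).2.1, formalComp_X (hW t ht).1]
  refine ⟨Y, ?_, fun t ht => ⟨hY0 t ht, ?_, ?_⟩⟩
  · have e0 := hYeq 0 i0
    have e1 := hYeq 1 i1
    have z₁ := (hh₁ 0 i0).1
    have z₂ := (hh₂ 0 i0).1
    rw [hm₁, hm₂, formalComp_assoc _ z₂ (hY0 1 i1), ← formalComp_assoc _ (hT _ hφ₁) z₁, hψ,
      formalComp_assoc _ hψ0 z₁, ← e0] at e1
    have e2 : formalComp (h₂ 0) (Y 1) = formalComp (h₂ 0) (Y 0) := by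
      refine formalComp_left_cancel (hT _ hφ₂) ?_ (coeff_zero_formalComp z₂ (hY0 1 i1))
        (coeff_zero_formalComp z₂ (hY0 0 i0)) e1
      rw [coeff_one_taylorAtZero]
      exact hφ₂.2.2
    exact formalComp_left_cancel z₂ hl₂ (hY0 1 i1) (hY0 0 i0) e2
  · have e := congrArg (coeff 1) (hYeq t ht)
    rw [coeff_one_formalComp (hY0 t ht), coeff_one_formalComp (hh₁ t ht).1, hψ1,
      hh₁.coeff_one hf₁ hx₀ t ht, hh₂.coeff_one hf₂ hx₀ t ht] at e
    have hexp := Complex.exp_ne_zero (-(2 * Real.pi * Complex.I) * lam * t)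
    rw [eq_div_iff hl₂]
    apply mul_right_cancel₀ hexp
    linear_combination e
  · have hYd := HasCoeffDeriv.formalComp ht (fun s hs => (hW s hs).1) (hL' t ht) (hW t ht).2
    obtain ⟨Y', hY'⟩ : ∃ Y', HasCoeffDeriv Y Y' t := ⟨_, hYd⟩
    have h3 := HasCoeffDeriv.formalComp ht hY0 (hh₂ t ht).2 hY'
    have h4 : HasCoeffDeriv (fun s => formalComp (h₂ s) (Y s)) _ t := fun n =>
      ((hW t ht).2 n).congr_of_mem (fun s hs => congrArg (coeff n) (hYeq s hs)) ht
    have h5 := h3.unique ht h4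
    beta_reduce at h5
    rw [← hYeq t ht, derivative_formalComp _ (hY0 t ht), formalComp_mul _ _ (hY0 t ht),
      formalComp_C_mul _ _ (hY0 t ht), map_neg] at h5
    have h6 := formalComp_derivative_ne_zero (hl₂' t ht) (hY0 t ht)
    have h7 : Y' = C (2 * Real.pi * Complex.I) *
        (formalComp (leafSlope lam f₂ (loop x₀ t).1) (Y t) -
          leafSlope lam f₁ (loop x₀ t).1 * derivative ℂ (Y t)) := by
      apply mul_left_cancel₀ h6
      linear_combination h5
    rw [← h7]
    exact hY'

theorem foliationConjugacy_of_conjugacy {lam : ℂ} {r : ℝ} {f₁ f₂ : ℂ × ℂ → ℂ}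
    (hf₁ : IsPerturbation r f₁) (hf₂ : IsPerturbation r f₂) {x₀ : ℂ} (hx₀ : x₀ ∈ disc r)
    (hx₀' : x₀ ≠ 0) (hlam : ∀ j m : ℕ, 0 < m → (j : ℂ) * lam ≠ m)
    {φ₁ φ₂ : ℂ → ℂ} (hφ₁ : IsDiffGerm φ₁) (hφ₂ : IsDiffGerm φ₂) {h₁ h₂ : ℝ → ℂ⟦X⟧}
    (hh₁ : IsFormalFirstIntegral lam f₁ x₀ h₁)
    (hh₂ : IsFormalFirstIntegral lam f₂ x₀ h₂) (hl₂ : coeff 1 (h₂ 0) ≠ 0)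
    (hm₁ : h₁ 1 = formalComp (taylorAtZero φ₁) (h₁ 0))
    (hm₂ : h₂ 1 = formalComp (taylorAtZero φ₂) (h₂ 0))
    {c : ℂ} {ψ : ℂ⟦X⟧} (hψ : IsFormalConjugacy c ψ φ₁ φ₂) :
    FormalFoliationConjugacy (disc r) (coeff 1 (h₁ 0) * c / coeff 1 (h₂ 0))
      (foliationForm lam f₁) (foliationForm lam f₂) := by
  obtain ⟨Y, hper, hY⟩ :=
    exists_conjugacy_along_loop hf₁ hf₂ hx₀ hφ₁ hφ₂ hh₁ hh₂ hl₂ hm₁ hm₂ hψ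
  refine foliationConjugacy_of_step hf₁ hf₂ _
    (fun n a => ∀ t ∈ Set.Icc (0 : ℝ) 1, a (loop x₀ t).1 = coeff n (Y t))
    (fun t ht => (hY t ht).1.symm) (fun t ht => (hY t ht).2.1.symm) ?_
  intro n hn Z hZ0 hZ hP
  obtain ⟨a, ha, hode, hext⟩ := exists_euler_solution_extending (μ := ((n : ℂ) - 1) * lam) hP hx₀ hx₀'
    (fun m hm => by
      obtain ⟨n, rfl⟩ : ∃ n', n = n' + 1 := ⟨n - 1, by omega⟩
      simpa using hlam n m hm)
    (u := fun t => coeff n (Y t)) (fun t ht => by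
      refine ((hY t ht).2.2 n).congr_deriv ?_
      rw [coeff_C_mul, coeff_leafSlope_sub _ _ _ _ (hY t ht).1]
      have hx := loop_mem_disc hx₀ t
      rw [coeff_nonlinearPart_congr (hf₁.2 _ hx) (hf₂.2 _ hx) (hY t ht).1 (hZ0 (loop x₀ t).1)
        fun k hk => (hZ k hk t ht).symm])
    (by rw [hper])
  exact ⟨a, ha, hode, hext⟩

/-! ### Joint analyticity of power series with analytic coefficients -/

theorem hasSum_coeff_mul_pow {h : ℕ → ℂ} {M B : ℝ} (hb : ∀ n, ‖h n‖ ≤ M * B ^ n) (hB : 0 < B)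
    {y : ℂ} (hy : ‖y‖ < B⁻¹) : HasSum (fun n => h n * y ^ n) (∑' n, h n * y ^ n) := by
  have hy' : B * ‖y‖ < 1 := by
    have := mul_lt_mul_of_pos_left hy hB
    rwa [mul_inv_cancel₀ hB.ne'] at this
  refine (Summable.of_norm_bounded (g := fun n => M * (B * ‖y‖) ^ n)
    ((summable_geometric_of_lt_one (by positivity) hy').mul_left M) fun n => ?_).hasSum
  rw [norm_mul, norm_pow, mul_pow, ← mul_assoc]
  exact mul_le_mul_of_nonneg_right (hb n) (by positivity)

/-- A power series in `y` whose coefficients are holomorphic in `s` and geometrically bounded is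
analytic in both variables: it is the pairing of an analytic `ℓ²`-valued function of `s` with an
analytic function of `y` with values in the dual of `ℓ²`. -/
theorem analyticAt_tsum_mul_pow {U : Set ℂ} (hU : IsOpen U) {h : ℕ → ℂ → ℂ}
    (hh : ∀ n, DifferentiableOn ℂ (h n) U) {M B : ℝ} (hB : 0 < B)
    (hb : ∀ n, ∀ s ∈ U, ‖h n s‖ ≤ M * B ^ n) {s₀ : ℂ} (hs₀ : s₀ ∈ U) :
    AnalyticAt ℂ (fun q : ℂ × ℂ => ∑' n, h n q.1 * q.2 ^ n) (s₀, 0) := by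
  set E := lp (fun _ : ℕ => ℂ) 2
  set ρ : ℝ := (2 * B)⁻¹ with hρ
  have hρ0 : 0 < ρ := by positivity
  have hρB : B * ρ = 1 / 2 := by rw [hρ]; field_simp
  have hρ0' : (ρ : ℂ) ≠ 0 := by exact_mod_cast hρ0.ne'
  have hgeo : Summable (fun n : ℕ => (1 / 2 : ℝ) ^ n) := summable_geometric_two
  set a : ℕ → ℂ → E := fun n s => (h n s * (ρ : ℂ) ^ n) • lp.single 2 n (1 : ℂ) with ha
  set b : ℕ → ℂ → (E →L[ℂ] ℂ) := fun n u => (u / ρ) ^ n • lp.evalCLM ℂ (fun _ : ℕ => ℂ) 2 n with hbdef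
  have hsingle : ∀ n, ‖(lp.single 2 n (1 : ℂ) : E)‖ = 1 := by
    intro n
    rw [lp.norm_single (by norm_num)]
    simp
  have ha1 : ∀ n, ∀ s ∈ U, ‖a n s‖ ≤ M * (1 / 2) ^ n := by
    intro n s hs
    rw [ha, norm_smul, hsingle, mul_one, norm_mul, norm_pow, Complex.norm_real,
      Real.norm_of_nonneg hρ0.le, ← hρB, mul_pow, ← mul_assoc]
    exact mul_le_mul_of_nonneg_right (hb n s hs) (by positivity)
  have heval : ∀ n, ‖lp.evalCLM ℂ (fun _ : ℕ => ℂ) 2 n‖ ≤ 1 := by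
    intro n
    refine ContinuousLinearMap.opNorm_le_bound _ zero_le_one fun v => ?_
    rw [one_mul]
    exact lp.norm_apply_le_norm (by norm_num) v n
  have hb1 : ∀ n, ∀ u ∈ Metric.ball (0 : ℂ) (ρ / 2), ‖b n u‖ ≤ (1 / 2) ^ n := by
    intro n u hu
    have hu' : ‖u‖ < ρ / 2 := by simpa using hu
    rw [hbdef, norm_smul, norm_pow, norm_div, Complex.norm_real, Real.norm_of_nonneg hρ0.le]
    have h1 : ‖u‖ / ρ ≤ 1 / 2 := by
      rw [div_le_iff₀ hρ0]; linarith
    calc (‖u‖ / ρ) ^ n * _ ≤ (1 / 2) ^ n * 1 := by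
          gcongr
          exact heval n
      _ = _ := mul_one _
  have hA : AnalyticAt ℂ (fun s => ∑' n, a n s) s₀ :=
    (Complex.differentiableOn_tsum_of_summable_norm (hgeo.mul_left M)
      (fun n => ((hh n).mul_const ((ρ : ℂ) ^ n)).smul_const (lp.single 2 n (1 : ℂ) : E)) hU
      ha1).analyticOnNhd hU s₀ hs₀
  have hBan : AnalyticAt ℂ (fun u => ∑' n, b n u) 0 :=
    (Complex.differentiableOn_tsum_of_summable_norm hgeo
      (fun n => DifferentiableOn.smul_const (by fun_prop) _) Metric.isOpen_ball
      hb1).analyticOnNhd Metric.isOpen_ball 0 (Metric.mem_ball_self (by positivity))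
  have hpair : AnalyticAt ℂ (fun q : ℂ × ℂ => (∑' n, b n q.2) (∑' n, a n q.1)) (s₀, 0) := by
    have h1 : AnalyticAt ℂ (fun q : ℂ × ℂ => ∑' n, b n q.2) (s₀, 0) :=
      AnalyticAt.fun_comp (g := fun u => ∑' n, b n u) hBan analyticAt_snd
    have h2 : AnalyticAt ℂ (fun q : ℂ × ℂ => ∑' n, a n q.1) (s₀, 0) :=
      AnalyticAt.fun_comp (g := fun s => ∑' n, a n s) hA analyticAt_fst
    exact ((ContinuousLinearMap.id ℂ (E →L[ℂ] ℂ)).analyticAt_bilinear _).comp (h1.prod h2)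
  refine hpair.congr ?_
  have hnhds : U ×ˢ Metric.ball (0 : ℂ) (ρ / 2) ∈ 𝓝 ((s₀, 0) : ℂ × ℂ) :=
    prod_mem_nhds (hU.mem_nhds hs₀) (Metric.ball_mem_nhds _ (by positivity))
  filter_upwards [hnhds] with q hq
  have hsa : Summable fun n => a n q.1 :=
    Summable.of_norm_bounded (hgeo.mul_left M) fun n => ha1 n _ hq.1
  have hsb : Summable fun n => b n q.2 := Summable.of_norm_bounded hgeo fun n => hb1 n _ hq.2
  have h1 : (∑' n, b n q.2) (∑' n, a n q.1) = ∑' n, b n q.2 (∑' m, a m q.1) :=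
    (ContinuousLinearMap.apply ℂ ℂ (∑' n, a n q.1)).map_tsum hsb
  rw [h1]
  refine tsum_congr fun n => ?_
  rw [(b n q.2).map_tsum hsa, tsum_eq_single n]
  · simp only [ha, hbdef, map_smul, _root_.smul_apply, smul_eq_mul]
    have : lp.evalCLM ℂ (fun _ : ℕ => ℂ) 2 n (lp.single 2 n (1 : ℂ)) = 1 := by
      change (lp.single 2 n (1 : ℂ) : E) n = 1
      simp
    rw [this, div_pow]
    field_simp
  · intro m hm
    simp only [ha, hbdef, map_smul, _root_.smul_apply, smul_eq_mul]
    have : lp.evalCLM ℂ (fun _ : ℕ => ℂ) 2 n (lp.single 2 m (1 : ℂ)) = 0 := by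
      change (lp.single 2 m (1 : ℂ) : E) n = 0
      rw [lp.single_apply_ne _ _ _ hm.symm]
    rw [this]
    ring

/-! ### Majorants for the transport equation -/

/-- Cauchy estimates for the coefficients of `f`, uniform on smaller discs. -/
theorem exists_coeff_yTaylor_bound {r ρ : ℝ} {f : ℂ × ℂ → ℂ} (hf : IsPerturbation r f) (hρ : ρ < r) :
    ∃ M A : ℝ, 0 < M ∧ 0 < A ∧ ∀ x ∈ Metric.closedBall (0 : ℂ) ρ, ∀ k,
      ‖coeff k (yTaylor f x)‖ ≤ M * A ^ k := by
  obtain ⟨u, v, -, hv, hsu, htv, huv⟩ := generalized_tube_lemma (isCompact_closedBall (0 : ℂ) ρ)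
    (isCompact_singleton (x := (0 : ℂ))) (isOpen_analyticAt ℂ f) (fun q hq =>
      hf.1 q ⟨Metric.closedBall_subset_ball hρ hq.1, hq.2⟩)
  obtain ⟨ε, hε, hball⟩ := Metric.isOpen_iff.1 hv 0 (htv rfl)
  have hsub : Metric.closedBall (0 : ℂ) (ε / 2) ⊆ v :=
    (Metric.closedBall_subset_ball (by linarith)).trans hball
  have han : ∀ x ∈ Metric.closedBall (0 : ℂ) ρ, ∀ y ∈ Metric.closedBall (0 : ℂ) (ε / 2),
      AnalyticAt ℂ f (x, y) := fun x hx y hy => huv ⟨hsu hx, hsub hy⟩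
  obtain ⟨M, hM⟩ := ((isCompact_closedBall (0 : ℂ) ρ).prod
    (isCompact_closedBall (0 : ℂ) (ε / 2))).exists_bound_of_continuousOn (f := f)
    (fun q hq => (han q.1 hq.1 q.2 hq.2).continuousAt.continuousWithinAt)
  refine ⟨|M| + 1, (ε / 2)⁻¹, by positivity, by positivity, fun x hx k => ?_⟩
  have h1 : DiffContOnCl ℂ (fun y => f (x, y)) (Metric.ball 0 (ε / 2)) := by
    refine DifferentiableOn.diffContOnCl fun y hy => ?_
    rw [closure_ball _ (by positivity)] at hy
    exact (analyticAt_slice (han x hx y hy)).differentiableAt.differentiableWithinAt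
  have h2 := Complex.norm_iteratedDeriv_le_of_forall_mem_sphere_norm_le k (by positivity) h1
    (C := |M| + 1) (fun y hy => (hM (x, y) ⟨hx, Metric.sphere_subset_closedBall hy⟩).trans
      ((le_abs_self M).trans (by linarith)))
  have h3 : (0 : ℝ) < k.factorial := by exact_mod_cast k.factorial_pos
  rw [yTaylor, coeff_taylorAtZero, norm_div, Complex.norm_natCast, div_le_iff₀ h3]
  refine h2.trans (le_of_eq ?_)
  rw [inv_pow]
  ring

theorem sum_mul_two_pow_le (n : ℕ) : ∑ j ∈ Finset.range n, (j : ℝ) * 2 ^ j ≤ n * 2 ^ n := by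
  calc ∑ j ∈ Finset.range n, (j : ℝ) * 2 ^ j ≤ ∑ j ∈ Finset.range n, (n : ℝ) * 2 ^ j := by
        refine Finset.sum_le_sum fun j hj => ?_
        have : (j : ℝ) ≤ n := by exact_mod_cast (Finset.mem_range.1 hj).le
        gcongr
    _ = n * (2 ^ n - 1) := by
        rw [← Finset.mul_sum, geom_sum_eq (by norm_num)]; norm_num
    _ ≤ n * 2 ^ n := by gcongr; linarith

/-- Solution of a triangular system of linear differential equations with geometrically bounded
coefficients: `(2A)ⁿ exp(n M |s|)` is a majorant for the `n`-th component. -/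
theorem exists_triangular_solution {D : Set ℂ} (hD : IsOpen D) (hDc : Convex ℝ D) (h0 : (0 : ℂ) ∈ D)
    {F : ℕ → ℂ → ℂ} (hF : ∀ k, DifferentiableOn ℂ (F k) D) {M A : ℝ} (hM : 0 < M) (hA : 0 < A)
    (hb : ∀ k, ∀ s ∈ D, ‖F k s‖ ≤ M * A ^ k) :
    ∃ g : ℕ → ℂ → ℂ, (∀ n, g n 0 = if n = 1 then 1 else 0) ∧
      (∀ n, ∀ s ∈ D, HasDerivAt (g n) (-∑ j ∈ Finset.range n, F (n - j) s * (j * g j s)) s) ∧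
      ∀ n, ∀ s ∈ D, ‖g n s‖ ≤ (2 * A)⁻¹ * (2 * A) ^ n * Real.exp (n * M * ‖s‖) := by
  obtain ⟨g, hg⟩ := exists_sequence_of_step (A := ℂ → ℂ) (fun n g =>
      (g n 0 = if n = 1 then 1 else 0) ∧
      ∀ s ∈ D, HasDerivAt (g n) (-∑ j ∈ Finset.range n, F (n - j) s * (j * g j s)) s)
    (by
      intro n g g' h ⟨h1, h2⟩
      rw [← h n le_rfl]
      refine ⟨h1, fun s hs => (h2 s hs).congr_deriv (congrArg Neg.neg ?_)⟩
      refine Finset.sum_congr rfl fun j hj => ?_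
      rw [h j (Finset.mem_range.1 hj).le])
    (by
      intro n g hg
      obtain ⟨G, hG⟩ := hDc.exists_forall_hasDerivWithinAt (𝕜 := ℂ)
        (f := fun s => -∑ j ∈ Finset.range n, F (n - j) s * (j * g j s))
        (DifferentiableOn.neg (DifferentiableOn.fun_sum fun j hj => (hF _).mul
          (DifferentiableOn.const_mul (fun s hs => ((hg j (Finset.mem_range.1 hj)).2 s
            hs).differentiableAt.differentiableWithinAt) _)))
      refine ⟨fun s => G s - G 0 + if n = 1 then 1 else 0, by simp, fun s hs => ?_⟩
      rw [Function.update_self]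
      have h1 := (((hG s hs).hasDerivAt (hD.mem_nhds hs)).sub_const (G 0)).add_const
        (if n = 1 then (1 : ℂ) else 0)
      refine h1.congr_deriv (congrArg Neg.neg ?_)
      refine Finset.sum_congr rfl fun j hj => ?_
      rw [Function.update_of_ne (Finset.mem_range.1 hj).ne])
  refine ⟨g, fun n => (hg n).1, fun n => (hg n).2, ?_⟩
  intro n
  induction n using Nat.strong_induction_on with
  | _ n ih =>
    intro s hs
    have hseg : ∀ τ ∈ Set.Icc (0 : ℝ) 1, (τ : ℂ) * s ∈ D := by
      intro τ hτ
      have := hDc.smul_mem_of_zero_mem h0 hs hτ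
      simpa using this
    set κ : ℝ := (2 * A)⁻¹ with hκ
    have hκ0 : 0 < κ := by positivity
    have hpath : ∀ τ ∈ Set.Icc (0 : ℝ) 1, HasDerivAt (fun τ : ℝ => g n (τ * s))
        (-(∑ j ∈ Finset.range n, F (n - j) (τ * s) * (j * g j (τ * s))) * s) τ := by
      intro τ hτ
      have h1 : HasDerivAt (fun τ : ℝ => (τ : ℂ) * s) s τ := by
        simpa using (Complex.ofRealCLM.hasDerivAt (x := τ)).mul_const s
      exact ((hg n).2 _ (hseg τ hτ)).comp τ h1
    have hBd : ∀ τ : ℝ, HasDerivAt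
        (fun τ : ℝ => κ * (2 * A) ^ n * Real.exp (n * M * ‖s‖ * τ))
        (κ * (2 * A) ^ n * (Real.exp (n * M * ‖s‖ * τ) * (n * M * ‖s‖))) τ := by
      intro τ
      have h1 : HasDerivAt (fun τ : ℝ => n * M * ‖s‖ * τ) (n * M * ‖s‖) τ := by
        simpa using (hasDerivAt_id τ).const_mul (n * M * ‖s‖)
      exact h1.exp.const_mul _
    have key := image_norm_le_of_norm_deriv_right_le_deriv_boundary (a := 0) (b := 1)
      (fun τ hτ => (hpath τ hτ).continuousAt.continuousWithinAt)
      (fun τ hτ => (hpath τ (Set.Ico_subset_Icc_self hτ)).hasDerivWithinAt) ?_ hBd ?_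
      (Set.right_mem_Icc.2 zero_le_one)
    · simpa using key
    · have h1 : g n ((0 : ℝ) * s) = if n = 1 then 1 else 0 := by
        rw [Complex.ofReal_zero, zero_mul]; exact (hg n).1
      rw [h1]
      split_ifs with hn
      · subst hn
        have h2 : (2 * A)⁻¹ * (2 * A) ^ 1 = 1 := by rw [pow_one, inv_mul_cancel₀ (by positivity)]
        rw [hκ, h2, mul_zero, Real.exp_zero, norm_one, mul_one]
      · rw [norm_zero]; positivity
    · intro τ hτ
      have hτ' := Set.Ico_subset_Icc_self hτ
      have hterm : ∀ j ∈ Finset.range n, ‖F (n - j) (τ * s) * (j * g j (τ * s))‖ ≤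
          M * κ * A ^ n * Real.exp (n * M * ‖s‖ * τ) * (j * 2 ^ j) := by
        intro j hj
        have hj' := Finset.mem_range.1 hj
        have h1 := ih j hj' _ (hseg τ hτ')
        have h2 := hb (n - j) _ (hseg τ hτ')
        have hn : ‖(τ : ℂ) * s‖ = τ * ‖s‖ := by
          rw [norm_mul, Complex.norm_real, Real.norm_of_nonneg hτ.1]
        rw [hn] at h1
        have h3 : Real.exp (j * M * (τ * ‖s‖)) ≤ Real.exp (n * M * ‖s‖ * τ) := by
          apply Real.exp_le_exp.2
          have h4 : (j : ℝ) ≤ n := by exact_mod_cast hj'.le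
          have h5 : 0 ≤ M * (τ * ‖s‖) := mul_nonneg hM.le (mul_nonneg hτ.1 (norm_nonneg _))
          nlinarith
        rw [norm_mul, norm_mul, Complex.norm_natCast]
        calc ‖F (n - j) (τ * s)‖ * (j * ‖g j (τ * s)‖)
            ≤ (M * A ^ (n - j)) * (j * (κ * (2 * A) ^ j * Real.exp (n * M * ‖s‖ * τ))) := by
              gcongr
              exact h1.trans (by gcongr)
          _ = M * κ * (A ^ (n - j) * A ^ j) * Real.exp (n * M * ‖s‖ * τ) * (j * 2 ^ j) := by
              rw [mul_pow]; ring
          _ = _ := by rw [← pow_add, Nat.sub_add_cancel hj'.le]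
      rw [norm_mul, norm_neg]
      calc ‖∑ j ∈ Finset.range n, F (n - j) (τ * s) * (j * g j (τ * s))‖ * ‖s‖
          ≤ (∑ j ∈ Finset.range n,
              M * κ * A ^ n * Real.exp (n * M * ‖s‖ * τ) * (j * 2 ^ j)) * ‖s‖ := by
            gcongr
            exact (norm_sum_le _ _).trans (Finset.sum_le_sum hterm)
        _ ≤ (M * κ * A ^ n * Real.exp (n * M * ‖s‖ * τ) * (n * 2 ^ n)) * ‖s‖ := by
            rw [← Finset.mul_sum]
            gcongr
            exact sum_mul_two_pow_le n
        _ = _ := by rw [mul_pow]; ring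

/-! ### Existence of normalized holonomies -/

/-- A solution of the transport equation in the logarithmic coordinate `s`, `x = x₀ exp s`, on an
open set containing the segment `[0, 2iπ]`, with initial value `y` at `s = 0` and coefficients that
grow at most geometrically. -/
structure LogFirstIntegral (lam : ℂ) (r : ℝ) (f : ℂ × ℂ → ℂ) (x₀ : ℂ) where
  /-- the domain of the coordinate `s` -/
  D : Set ℂ
  isOpen : IsOpen D
  mem : ∀ t ∈ Set.Icc (0 : ℝ) 1, 2 * Real.pi * Complex.I * t ∈ D
  mem_disc : ∀ s ∈ D, x₀ * Complex.exp s ∈ disc r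
  /-- the expansion in powers of `y` -/
  U : ℂ → ℂ⟦X⟧
  /-- the bound for the coefficients -/
  M : ℝ
  /-- the rate of growth of the coefficients -/
  B : ℝ
  B_pos : 0 < B
  bound : ∀ n, ∀ s ∈ D, ‖coeff n (U s)‖ ≤ M * B ^ n
  U_zero : U 0 = X
  coeff_zero : ∀ s ∈ D, coeff 0 (U s) = 0
  hasDerivAt : ∀ n, ∀ s ∈ D, HasDerivAt (fun s => coeff n (U s))
    (-coeff n (leafSlope lam f (x₀ * Complex.exp s) * derivative ℂ (U s))) s

theorem coeff_leafSlope_mul_derivative {lam : ℂ} {f : ℂ × ℂ → ℂ} {x : ℂ} (hf : f (x, 0) = 0)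
    (Z : ℂ⟦X⟧) (n : ℕ) : coeff n (leafSlope lam f x * derivative ℂ Z) = n * lam * coeff n Z +
      ∑ j ∈ Finset.range n, coeff (n - j) (yTaylor f x) * (j * coeff j Z) := by
  have h0 : coeff 0 (yTaylor f x) = 0 := by rw [yTaylor, coeff_zero_taylorAtZero, hf]
  rw [leafSlope, mul_assoc, add_mul, map_add, coeff_C_mul, coeff_X_mul_derivative, coeff_mul,
    ← Finset.Nat.sum_antidiagonal_swap, Finset.Nat.sum_antidiagonal_eq_sum_range_succ_mk,
    Finset.sum_range_succ]
  simp only [Prod.fst_swap, Prod.snd_swap, coeff_X_mul_derivative, Nat.sub_self, h0, zero_mul,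
    add_zero]
  ring

theorem exists_logFirstIntegral (lam : ℂ) {r : ℝ} {f : ℂ × ℂ → ℂ} (hf : IsPerturbation r f) {x₀ : ℂ}
    (hx₀ : x₀ ∈ disc r) (hx₀' : x₀ ≠ 0) : Nonempty (LogFirstIntegral lam r f x₀) := by
  have hpos : 0 < ‖x₀‖ := norm_pos_iff.2 hx₀'
  obtain ⟨ρ, hρ1, hρ2⟩ := exists_between (show ‖x₀‖ < r by simpa using hx₀)
  obtain ⟨M, A, hM, hA, hbound⟩ := exists_coeff_yTaylor_bound hf hρ2
  -- a convex neighbourhood of the segment on which `|x₀ exp s| < ρ`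
  set D : Set ℂ := {s : ℂ | s.re < Real.log (ρ / ‖x₀‖)} ∩ Metric.ball 0 8 with hD
  have hDo : IsOpen D := (isOpen_lt Complex.continuous_re continuous_const).inter Metric.isOpen_ball
  have hDc : Convex ℝ D := (convex_halfSpace_re_lt _).inter (convex_ball _ _)
  have hlog : 0 < Real.log (ρ / ‖x₀‖) := Real.log_pos ((one_lt_div hpos).2 hρ1)
  have hmem : ∀ t ∈ Set.Icc (0 : ℝ) 1, 2 * Real.pi * Complex.I * t ∈ D := by
    intro t ht
    have e : 2 * Real.pi * Complex.I * t = ((2 * Real.pi * t : ℝ) : ℂ) * Complex.I := by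
      push_cast; ring
    rw [e]
    refine ⟨by simpa using hlog, ?_⟩
    rw [mem_ball_zero_iff, norm_mul, Complex.norm_I, mul_one, Complex.norm_real,
      Real.norm_of_nonneg (by have := Real.pi_pos; have := ht.1; positivity)]
    have h1 := Real.pi_lt_d2
    have h2 := Real.pi_pos
    nlinarith [ht.1, ht.2]
  have h0D : (0 : ℂ) ∈ D := by simpa using hmem 0 (by simp)
  have hxρ : ∀ s ∈ D, x₀ * Complex.exp s ∈ Metric.closedBall (0 : ℂ) ρ := by
    intro s hs
    rw [mem_closedBall_zero_iff, norm_mul, Complex.norm_exp]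
    have h1 : Real.exp s.re ≤ ρ / ‖x₀‖ := by
      rw [← Real.exp_log (show 0 < ρ / ‖x₀‖ from div_pos (hpos.trans hρ1) hpos)]
      exact Real.exp_le_exp.2 (le_of_lt hs.1)
    calc ‖x₀‖ * Real.exp s.re ≤ ‖x₀‖ * (ρ / ‖x₀‖) := by gcongr
      _ = ρ := by field_simp
  have hxr : ∀ s ∈ D, x₀ * Complex.exp s ∈ disc r := fun s hs =>
    Metric.closedBall_subset_ball hρ2 (hxρ s hs)
  -- the factor `exp (k lam s)` removes the linear term of the equation
  set F : ℕ → ℂ → ℂ := fun k s =>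
    coeff k (yTaylor f (x₀ * Complex.exp s)) * Complex.exp (k * (lam * s)) with hF
  have hFd : ∀ k, DifferentiableOn ℂ (F k) D := by
    intro k s hs
    have h1 := (analyticAt_coeff_yTaylor (hf.1 (x₀ * Complex.exp s, 0) ⟨hxr s hs, rfl⟩)
      k).differentiableAt
    have h2 : DifferentiableAt ℂ (fun s => x₀ * Complex.exp s) s := by fun_prop
    have h3 : DifferentiableAt ℂ (fun s => Complex.exp (k * (lam * s))) s := by fun_prop
    exact ((DifferentiableAt.comp s h1 h2).mul h3).differentiableWithinAt
  have hexp : ∀ s ∈ D, ‖lam * s‖ ≤ ‖lam‖ * 8 := by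
    intro s hs
    have : ‖s‖ < 8 := by simpa using hs.2
    rw [norm_mul]
    gcongr
  have hexpn : ∀ k : ℕ, ∀ z : ℂ, ‖z‖ ≤ ‖lam‖ * 8 →
      ‖Complex.exp (k * z)‖ ≤ Real.exp (‖lam‖ * 8) ^ k := by
    intro k z hz
    rw [Complex.exp_nat_mul, norm_pow, Complex.norm_exp]
    gcongr
    exact (Complex.re_le_norm _).trans hz
  have hFb : ∀ k, ∀ s ∈ D, ‖F k s‖ ≤ M * (A * Real.exp (‖lam‖ * 8)) ^ k := by
    intro k s hs
    have h1 : M * (A * Real.exp (‖lam‖ * 8)) ^ k = M * A ^ k * Real.exp (‖lam‖ * 8) ^ k := by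
      rw [mul_pow]; ring
    rw [hF, norm_mul, h1]
    exact mul_le_mul (hbound _ (hxρ s hs) k) (hexpn k _ (hexp s hs)) (norm_nonneg _) (by positivity)
  obtain ⟨g, hg0, hgd, hgb⟩ := exists_triangular_solution hDo hDc h0D hFd hM
    (show 0 < A * Real.exp (‖lam‖ * 8) by positivity) hFb
  set A' := A * Real.exp (‖lam‖ * 8) with hA'
  have hA'0 : 0 < A' := by positivity
  refine ⟨{
    D := D
    isOpen := hDo
    mem := hmem
    mem_disc := hxr
    U := fun s => PowerSeries.mk fun n => Complex.exp (n * -(lam * s)) * g n s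
    M := (2 * A')⁻¹
    B := 2 * A' * Real.exp (M * 8) * Real.exp (‖lam‖ * 8)
    B_pos := by positivity
    bound := ?_
    U_zero := ?_
    coeff_zero := ?_
    hasDerivAt := ?_ }⟩
  · intro n s hs
    have h8 : ‖s‖ < 8 := by simpa using hs.2
    rw [coeff_mk, norm_mul]
    have h1 : Real.exp (n * M * ‖s‖) ≤ Real.exp (M * 8) ^ n := by
      rw [← Real.exp_nat_mul, mul_assoc]
      gcongr
    calc ‖Complex.exp (n * -(lam * s))‖ * ‖g n s‖
        ≤ Real.exp (‖lam‖ * 8) ^ n * ((2 * A')⁻¹ * (2 * A') ^ n * Real.exp (M * 8) ^ n) := by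
          gcongr
          · exact hexpn n _ (by rw [norm_neg]; exact hexp s hs)
          · exact (hgb n s hs).trans (by gcongr)
      _ = _ := by rw [mul_pow, mul_pow]; ring
  · ext n
    rw [coeff_mk, hg0, coeff_X]
    simp
  · intro s hs
    have h1 : g 0 s = 0 := by
      have h2 := hDc.is_const_of_fderivWithin_eq_zero (𝕜 := ℂ) (f := g 0)
        (fun z hz => (hgd 0 z hz).differentiableAt.differentiableWithinAt) (fun z hz => by
          rw [fderivWithin_of_isOpen hDo hz]
          ext
          simpa using (hgd 0 z hz).deriv) hs h0D
      rw [h2, hg0]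
      simp
    rw [coeff_mk, h1, mul_zero]
  · intro n s hs
    simp only [coeff_mk]
    have h1 : HasDerivAt (fun s : ℂ => (n : ℂ) * -(lam * s)) (n * -lam) s := by
      simpa using (((hasDerivAt_id s).const_mul lam).neg).const_mul (n : ℂ)
    refine (h1.cexp.mul (hgd n s hs)).congr_deriv ?_
    rw [coeff_leafSlope_mul_derivative (hf.2 _ (hxr s hs))]
    simp only [coeff_mk]
    have h2 : ∀ j ∈ Finset.range n, Complex.exp (n * -(lam * s)) * (F (n - j) s * (j * g j s)) =
        coeff (n - j) (yTaylor f (x₀ * Complex.exp s)) *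
          (j * (Complex.exp (j * -(lam * s)) * g j s)) := by
      intro j hj
      have h3 : Complex.exp (j * -(lam * s)) =
          Complex.exp (n * -(lam * s)) * Complex.exp ((n - j : ℕ) * (lam * s)) := by
        rw [← Complex.exp_add, Nat.cast_sub (Finset.mem_range.1 hj).le]
        congr 1
        ring
      rw [h3, hF]
      ring
    rw [← Finset.sum_congr rfl h2, ← Finset.mul_sum]
    ring

namespace LogFirstIntegral

variable {lam : ℂ} {r : ℝ} {f : ℂ × ℂ → ℂ} {x₀ : ℂ} (E : LogFirstIntegral lam r f x₀)

/-- The transport equation restricted to a segment. -/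
theorem hasCoeffDeriv_path {c s : ℂ} {τ : ℝ} (h : c + τ * s ∈ E.D) :
    HasCoeffDeriv (fun τ : ℝ => E.U (c + τ * s))
      (C (-s) * leafSlope lam f (x₀ * Complex.exp (c + τ * s)) * derivative ℂ (E.U (c + τ * s))) τ := by
  intro n
  have h1 : HasDerivAt (fun τ : ℝ => c + (τ : ℂ) * s) s τ := by
    simpa using ((Complex.ofRealCLM.hasDerivAt (x := τ)).mul_const s).const_add c
  refine ((E.hasDerivAt n _ h).comp τ h1).hasDerivWithinAt.congr_deriv ?_
  rw [mul_assoc, coeff_C_mul]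
  ring

theorem isFormalFirstIntegral :
    IsFormalFirstIntegral lam f x₀ fun t => E.U (2 * Real.pi * Complex.I * t) := by
  intro t ht
  refine ⟨E.coeff_zero _ (E.mem t ht), ?_⟩
  have h1 := E.hasCoeffDeriv_path (c := 0) (s := 2 * Real.pi * Complex.I) (τ := t)
    (by simpa [mul_comm] using E.mem t ht)
  simpa only [zero_add, mul_comm (_ : ℂ) (2 * Real.pi * Complex.I)] using! h1

theorem zero_mem : (0 : ℂ) ∈ E.D := by simpa using E.mem 0 (by simp)

theorem two_pi_I_mem : 2 * Real.pi * Complex.I ∈ E.D := by simpa using E.mem 1 (by simp)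

/-- Translation by the period `2iπ` amounts to composition with a fixed series. -/
theorem U_add_two_pi_I (hf : IsPerturbation r f) :
    ∀ᶠ s in 𝓝 (0 : ℂ), E.U (2 * Real.pi * Complex.I + s) =
      formalComp (E.U (2 * Real.pi * Complex.I)) (E.U s) := by
  obtain ⟨δ, hδ, hball⟩ := Metric.isOpen_iff.1 E.isOpen 0 E.zero_mem
  obtain ⟨δ', hδ', hball'⟩ := Metric.isOpen_iff.1 E.isOpen _ E.two_pi_I_mem
  filter_upwards [Metric.ball_mem_nhds (0 : ℂ) hδ, Metric.ball_mem_nhds (0 : ℂ) hδ'] with s hs hs'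
  have hτ : ∀ τ ∈ Set.Icc (0 : ℝ) 1, ‖(τ : ℂ) * s‖ ≤ ‖s‖ := by
    intro τ hτ
    rw [norm_mul, Complex.norm_real, Real.norm_of_nonneg hτ.1]
    exact mul_le_of_le_one_left (norm_nonneg _) hτ.2
  have hm : ∀ τ ∈ Set.Icc (0 : ℝ) 1, 0 + (τ : ℂ) * s ∈ E.D := fun τ h => hball (by
    rw [zero_add, mem_ball_zero_iff]
    exact (hτ τ h).trans_lt (by simpa using hs))
  have hm' : ∀ τ ∈ Set.Icc (0 : ℝ) 1, 2 * Real.pi * Complex.I + (τ : ℂ) * s ∈ E.D :=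
    fun τ h => hball' (by
      rw [mem_ball_iff_norm, add_sub_cancel_left]
      exact (hτ τ h).trans_lt (by simpa using hs'))
  have hexp : ∀ z, Complex.exp (2 * Real.pi * Complex.I + z) = Complex.exp (0 + z) := fun z => by
    rw [Complex.exp_add, Complex.exp_two_pi_mul_I, zero_add, one_mul]
  have key := transport_unique' (μ := -s * lam)
    (G := fun τ : ℝ => C (-s) * leafSlope lam f (x₀ * Complex.exp (0 + τ * s)))
    (u := fun τ : ℝ => E.U (2 * Real.pi * Complex.I + τ * s))
    (v := fun τ : ℝ => formalComp (E.U (2 * Real.pi * Complex.I)) (E.U (0 + τ * s)))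
    (fun _ _ => coeff_zero_loopSlope _ _ _ _)
    (fun τ h => coeff_one_loopSlope _ (hf.2 _ (E.mem_disc _ (hm τ h))))
    (fun τ h => by
      have := E.hasCoeffDeriv_path (hm' τ h)
      rwa [hexp] at this)
    (fun τ h => HasCoeffDeriv.const_comp _ h (fun τ' h' => E.coeff_zero _ (hm τ' h'))
      (G := fun τ : ℝ => C (-s) * leafSlope lam f (x₀ * Complex.exp (0 + τ * s)))
      (E.hasCoeffDeriv_path (hm τ h)))
    (by simp [E.U_zero, formalComp_X_right]) 1 (by simp)
  simpa using key

/-- The sum of the series, an analytic function of `(s, y)`. -/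
noncomputable def sum (q : ℂ × ℂ) : ℂ := ∑' n, coeff n (E.U q.1) * q.2 ^ n

theorem analyticAt_sum {s : ℂ} (hs : s ∈ E.D) : AnalyticAt ℂ E.sum (s, 0) :=
  analyticAt_tsum_mul_pow (h := fun n s => coeff n (E.U s)) E.isOpen
    (fun n s hs => (E.hasDerivAt n s hs).differentiableAt.differentiableWithinAt) E.B_pos E.bound hs

theorem taylorAtZero_sum {s : ℂ} (hs : s ∈ E.D) :
    taylorAtZero (fun y => E.sum (s, y)) = E.U s := by
  rw [taylorAtZero_eq_mk (a := fun n => coeff n (E.U s))]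
  · ext n; simp
  · have h1 : ∀ᶠ y in 𝓝 (0 : ℂ), y ∈ Metric.ball (0 : ℂ) E.B⁻¹ :=
      Metric.ball_mem_nhds _ (inv_pos.2 E.B_pos)
    filter_upwards [h1] with y hy
    exact hasSum_coeff_mul_pow (fun n => E.bound n s hs) E.B_pos (by simpa using hy)

theorem sum_zero {s : ℂ} (hs : s ∈ E.D) : E.sum (s, 0) = 0 := by
  have := E.coeff_zero s hs
  rwa [← E.taylorAtZero_sum hs, coeff_zero_taylorAtZero] at this

end LogFirstIntegral

/-- The branch of `log (x / x₀)` near the point of parameter `t` of the loop. -/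
noncomputable def logBranch (x₀ : ℂ) (t : ℝ) (x : ℂ) : ℂ :=
  2 * Real.pi * Complex.I * t + Complex.log (x / (loop x₀ t).1)

theorem analyticAt_logBranch {x₀ : ℂ} (hx₀ : x₀ ≠ 0) (t : ℝ) :
    AnalyticAt ℂ (logBranch x₀ t) (loop x₀ t).1 := by
  refine analyticAt_const.fun_add (AnalyticAt.clog (by fun_prop) ?_)
  rw [div_self (loop_ne_zero hx₀ t)]
  exact Complex.one_mem_slitPlane

theorem logBranch_loop {x₀ : ℂ} (hx₀ : x₀ ≠ 0) (t : ℝ) :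
    logBranch x₀ t (loop x₀ t).1 = 2 * Real.pi * Complex.I * t := by
  rw [logBranch, div_self (loop_ne_zero hx₀ t), Complex.log_one, add_zero]

theorem exp_logBranch {x₀ : ℂ} (hx₀ : x₀ ≠ 0) (t : ℝ) {x : ℂ} (hx : x ≠ 0) :
    x₀ * Complex.exp (logBranch x₀ t x) = x := by
  have h := loop_ne_zero hx₀ t
  rw [logBranch, Complex.exp_add, Complex.exp_log (div_ne_zero hx h), ← mul_assoc]
  exact mul_div_cancel₀ _ h

theorem hasDerivAt_logBranch {x₀ : ℂ} (hx₀ : x₀ ≠ 0) (t : ℝ) :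
    ∀ᶠ x in 𝓝 (loop x₀ t).1, HasDerivAt (logBranch x₀ t) x⁻¹ x := by
  have h := loop_ne_zero hx₀ t
  have h1 : ∀ᶠ x in 𝓝 (loop x₀ t).1, x / (loop x₀ t).1 ∈ Complex.slitPlane := by
    refine ContinuousAt.eventually_mem (by fun_prop) (Complex.isOpen_slitPlane.mem_nhds ?_)
    rw [div_self h]
    exact Complex.one_mem_slitPlane
  filter_upwards [h1, isOpen_ne.mem_nhds h] with x hx hx'
  have h2 := ((hasDerivAt_id x).div_const (loop x₀ t).1).clog hx
  refine (h2.const_add (2 * Real.pi * Complex.I * (t : ℂ))).congr_deriv ?_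
  simp only [id]
  have : x ≠ 0 := hx'
  field_simp

/-- Nearby branches of the logarithm agree. -/
theorem logBranch_eventuallyEq {x₀ : ℂ} (hx₀ : x₀ ≠ 0) {s t : ℝ} (hst : |s - t| < 1 / 4) :
    logBranch x₀ s =ᶠ[𝓝 (loop x₀ s).1] logBranch x₀ t := by
  have hs := loop_ne_zero hx₀ s
  have ht := loop_ne_zero hx₀ t
  have h1 : ∀ᶠ x in 𝓝 (loop x₀ s).1, |(Complex.log (x / (loop x₀ s).1)).im| < Real.pi / 2 := by
    have hc : ContinuousAt (fun x => |(Complex.log (x / (loop x₀ s).1)).im|) (loop x₀ s).1 := by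
      refine (Complex.continuous_im.continuousAt.comp (ContinuousAt.clog (by fun_prop) ?_)).abs
      rw [div_self hs]
      exact Complex.one_mem_slitPlane
    refine hc.eventually_lt continuousAt_const ?_
    simp [div_self hs, Real.pi_pos]
  filter_upwards [h1, isOpen_ne.mem_nhds hs] with x hx hx'
  have hx0 : x ≠ 0 := hx'
  set z := 2 * Real.pi * Complex.I * (s - t) + Complex.log (x / (loop x₀ s).1) with hz
  have hzim : z.im = 2 * Real.pi * (s - t) + (Complex.log (x / (loop x₀ s).1)).im := by
    have e : 2 * Real.pi * Complex.I * ((s : ℂ) - t) = ((2 * Real.pi * (s - t) : ℝ) : ℂ) * Complex.I := by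
      push_cast; ring
    rw [hz, Complex.add_im, e, Complex.im_ofReal_mul, Complex.I_im, mul_one]
  have hpi := Real.pi_pos
  rw [abs_lt] at hx hst
  have hexp : Complex.exp z = x / (loop x₀ t).1 := by
    have h2 : (loop x₀ s).1 = (loop x₀ t).1 * Complex.exp (2 * Real.pi * Complex.I * (s - t)) := by
      simp only [loop]
      rw [mul_assoc x₀, ← Complex.exp_add]
      congr 2
      ring
    rw [hz, Complex.exp_add, Complex.exp_log (div_ne_zero hx0 hs), mul_div_assoc', mul_comm _ x, h2,
      mul_div_mul_right _ _ (Complex.exp_ne_zero _)]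
  have hlog : Complex.log (x / (loop x₀ t).1) = z := by
    rw [← hexp]
    refine Complex.log_exp ?_ ?_
    · rw [hzim]; nlinarith
    · rw [hzim]; nlinarith
  rw [logBranch, logBranch, hlog, hz]
  ring

namespace LogFirstIntegral

variable {lam : ℂ} {r : ℝ} {f : ℂ × ℂ → ℂ} {x₀ : ℂ} (E : LogFirstIntegral lam r f x₀)

/-- The germ at `(x₀ exp (2iπt), 0)` obtained from the branch `logBranch x₀ t` of
`log (x / x₀)`. -/
noncomputable def germ (t : ℝ) (q : ℂ × ℂ) : ℂ := E.sum (logBranch x₀ t q.1, q.2)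

theorem germ_eq (t : ℝ) (q : ℂ × ℂ) : E.germ t q = E.sum (logBranch x₀ t q.1, q.2) := rfl

theorem analyticAt_germ (hx₀ : x₀ ≠ 0) {t : ℝ} (ht : t ∈ Set.Icc (0 : ℝ) 1) :
    AnalyticAt ℂ (E.germ t) ((loop x₀ t).1, 0) := by
  have h1 : AnalyticAt ℂ (fun q : ℂ × ℂ => logBranch x₀ t q.1) ((loop x₀ t).1, 0) :=
    AnalyticAt.fun_comp (g := logBranch x₀ t) (analyticAt_logBranch hx₀ t) analyticAt_fst
  have h2 := h1.prod (analyticAt_snd (𝕜 := ℂ) (p := ((loop x₀ t).1, (0 : ℂ))))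
  refine AnalyticAt.fun_comp (g := E.sum) ?_ h2
  rw [logBranch_loop hx₀]
  exact E.analyticAt_sum (E.mem t ht)

theorem eventually_logBranch_mem (hx₀ : x₀ ≠ 0) {t : ℝ} (ht : t ∈ Set.Icc (0 : ℝ) 1) :
    ∀ᶠ x in 𝓝 (loop x₀ t).1, logBranch x₀ t x ∈ E.D :=
  (analyticAt_logBranch hx₀ t).continuousAt.eventually_mem
    (E.isOpen.mem_nhds (by rw [logBranch_loop hx₀]; exact E.mem t ht))

theorem isAnalyticContinuation (hx₀ : x₀ ≠ 0) : IsAnalyticContinuation (loop x₀) E.germ := by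
  intro t ht
  refine ⟨E.analyticAt_germ hx₀ ht, ?_⟩
  have h1 : ∀ᶠ s in 𝓝[Set.Icc (0 : ℝ) 1] t, s ∈ Metric.ball t (1 / 4) :=
    mem_nhdsWithin_of_mem_nhds (Metric.ball_mem_nhds _ (by norm_num))
  filter_upwards [h1] with s hs
  have h2 : Tendsto (fun q : ℂ × ℂ => q.1) (𝓝 (loop x₀ s)) (𝓝 (loop x₀ s).1) :=
    continuous_fst.continuousAt
  filter_upwards [h2.eventually (logBranch_eventuallyEq hx₀ (by simpa [Real.dist_eq] using hs))]
    with q hq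
  rw [germ_eq, germ_eq, hq]

theorem yTaylor_germ {t : ℝ} {x : ℂ} (h : logBranch x₀ t x ∈ E.D) :
    yTaylor (E.germ t) x = E.U (logBranch x₀ t x) := by
  simp only [yTaylor, germ_eq]
  exact E.taylorAtZero_sum h

theorem transport_germ_zero (hf : IsPerturbation r f) (hx : x₀ ∈ disc r) (hx₀ : x₀ ≠ 0) :
    transport lam f (E.germ 0) =ᶠ[𝓝 (x₀, 0)] 0 := by
  have i0 : (0 : ℝ) ∈ Set.Icc (0 : ℝ) 1 := by simp
  have hl : (loop x₀ 0).1 = x₀ := by rw [loop_zero]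
  have hg := E.analyticAt_germ hx₀ i0
  have hd := hasDerivAt_logBranch hx₀ 0
  have hm := E.eventually_logBranch_mem hx₀ i0
  rw [hl] at hg hd hm
  have hfx := hf.1 (x₀, 0) ⟨hx, rfl⟩
  refine eventuallyEq_of_yTaylor_eq (analyticAt_transport hfx hg) analyticAt_const ?_
  filter_upwards [hd, hm.eventually_nhds, eventually_analyticAt_slice_left hg, isOpen_ne.mem_nhds hx₀,
    Metric.isOpen_ball.mem_nhds hx] with x hdx hmx hgx hx0 hxr
  have hx0' : x ≠ 0 := hx0
  have h0 : yTaylor (0 : ℂ × ℂ → ℂ) x = 0 := by simpa [yTaylor] using! taylorAtZero_const 0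
  rw [h0, yTaylor_transport (hf.1 (x, 0) ⟨hxr, rfl⟩) hgx, E.yTaylor_germ hmx.self_of_nhds]
  ext n
  have h1 := (hasDerivAt_coeff_yTaylor hgx n)
  have h2 := (E.hasDerivAt n _ hmx.self_of_nhds).comp x hdx
  have h3 := h1.unique (h2.congr_of_eventuallyEq (by
    filter_upwards [hmx] with x' hx'
    rw [E.yTaylor_germ hx']
    rfl))
  rw [exp_logBranch hx₀ 0 hx0'] at h3
  rw [map_add, coeff_C_mul, h3, map_zero]
  field_simp
  ring

theorem isMinimalFirstIntegral (hf : IsPerturbation r f) (hx : x₀ ∈ disc r) (hx₀ : x₀ ≠ 0) :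
    IsMinimalFirstIntegral (foliationForm lam f) (x₀, 0) (E.germ 0) ∧
      fderiv ℂ (E.germ 0) (x₀, 0) (0, 1) = 1 := by
  have i0 : (0 : ℝ) ∈ Set.Icc (0 : ℝ) 1 := by simp
  have hl : (loop x₀ 0).1 = x₀ := by rw [loop_zero]
  have hg := E.analyticAt_germ hx₀ i0
  rw [hl] at hg
  have hb : logBranch x₀ 0 x₀ = 0 := by
    have := logBranch_loop hx₀ 0
    simpa [hl] using this
  have hY : partialY (E.germ 0) (x₀, 0) = 1 := by
    have h1 : coeff 1 (yTaylor (E.germ 0) x₀) = 1 := by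
      rw [E.yTaylor_germ (by rw [hb]; exact E.zero_mem), hb, E.U_zero, coeff_one_X]
    rw [yTaylor, coeff_one_taylorAtZero] at h1
    rw [← h1]
    exact (hasDerivAt_slice hg).deriv.symm
  refine ⟨⟨hg, ?_, ?_, ?_⟩, hY⟩
  · rw [germ_eq, hb]
    exact E.sum_zero E.zero_mem
  · intro h
    have : partialY (E.germ 0) (x₀, 0) = 0 := by rw [partialY, h]; rfl
    rw [hY] at this
    exact one_ne_zero this
  · have h1 : ∀ᶠ q in 𝓝 (x₀, (0 : ℂ)), partialY (E.germ 0) q ≠ 0 :=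
      hg.partialY.continuousAt.eventually_ne (by rw [hY]; exact one_ne_zero)
    have h2 : ∀ᶠ q in 𝓝 (x₀, (0 : ℂ)), q.1 ≠ 0 :=
      continuous_fst.continuousAt.eventually_ne hx₀
    filter_upwards [h1, h2, E.transport_germ_zero hf hx hx₀] with q hq1 hq2 hq3 v
    have hq4 : q.1 * partialX (E.germ 0) q + (lam + f q) * q.2 * partialY (E.germ 0) q = 0 := hq3
    have h3 : q.1 * fderiv ℂ (E.germ 0) q v = partialY (E.germ 0) q * foliationForm lam f q v := by
      rw [fderiv_apply_eq_partial]
      simp only [foliationForm, _root_.sub_apply, _root_.smul_apply,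
        ContinuousLinearMap.coe_snd', ContinuousLinearMap.coe_fst', smul_eq_mul]
      linear_combination v.1 * hq4
    constructor
    · intro h
      rw [h, mul_zero] at h3
      exact (mul_eq_zero.1 h3.symm).resolve_left hq1
    · intro h
      rw [h, mul_zero] at h3
      exact (mul_eq_zero.1 h3).resolve_left hq2

theorem isMonodromy (hf : IsPerturbation r f) (hx : x₀ ∈ disc r) (hx₀ : x₀ ≠ 0) :
    IsMonodromy x₀ (E.germ 0) fun z => E.sum (2 * Real.pi * Complex.I, z) := by
  have i0 : (0 : ℝ) ∈ Set.Icc (0 : ℝ) 1 := by simp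
  have i1 : (1 : ℝ) ∈ Set.Icc (0 : ℝ) 1 := by simp
  have hl : (loop x₀ 0).1 = x₀ := by rw [loop_zero]
  have hl1 : (loop x₀ 1).1 = x₀ := by rw [loop_one]
  have hg := E.analyticAt_germ hx₀ i0
  have hg1 := E.analyticAt_germ hx₀ i1
  have hm := E.eventually_logBranch_mem hx₀ i0
  have hm1 := E.eventually_logBranch_mem hx₀ i1
  rw [hl] at hg hm
  rw [hl1] at hg1 hm1
  have hb1 : ∀ x, logBranch x₀ 1 x = 2 * Real.pi * Complex.I + logBranch x₀ 0 x := by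
    intro x
    simp [logBranch, loop_zero, loop_one]
  have hφa : AnalyticAt ℂ (fun z => E.sum (2 * Real.pi * Complex.I, z)) 0 :=
    analyticAt_slice (E.analyticAt_sum E.two_pi_I_mem)
  have hφ0 := E.sum_zero E.two_pi_I_mem
  have hg0 : E.germ 0 (x₀, 0) = 0 := (E.isMinimalFirstIntegral hf hx hx₀).1.2.1
  refine ⟨⟨hφa, hφ0, ?_⟩, E.germ, E.isAnalyticContinuation hx₀, EventuallyEq.rfl, ?_⟩
  · rw [← coeff_one_taylorAtZero, E.taylorAtZero_sum E.two_pi_I_mem]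
    have h1 := E.isFormalFirstIntegral.coeff_one hf hx 1 i1
    simp only [Complex.ofReal_one, mul_one, Complex.ofReal_zero, mul_zero, E.U_zero,
      coeff_one_X, one_mul] at h1
    rw [h1]
    exact Complex.exp_ne_zero _
  · refine eventuallyEq_of_yTaylor_eq hg1 (AnalyticAt.comp (by rwa [hg0]) hg) ?_
    have hc : Tendsto (logBranch x₀ 0) (𝓝 x₀) (𝓝 0) := by
      have h1 := (analyticAt_logBranch hx₀ 0).continuousAt
      have h2 := logBranch_loop hx₀ 0
      rw [hl] at h1 h2
      rw [Complex.ofReal_zero, mul_zero] at h2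
      simpa only [ContinuousAt, h2] using h1
    filter_upwards [hm, hm1, hc.eventually (E.U_add_two_pi_I hf),
      eventually_analyticAt_slice_left hg] with x hx1 hx2 hx3 hx4
    rw [E.yTaylor_germ hx2, hb1, hx3, ← E.taylorAtZero_sum E.two_pi_I_mem, ← E.yTaylor_germ hx1]
    exact (taylorAtZero_comp hφa (analyticAt_slice hx4) (E.sum_zero hx1)).symm

end LogFirstIntegral

theorem exists_normalizedHolonomy (lam : ℂ) {r : ℝ} {f : ℂ × ℂ → ℂ} (hf : IsPerturbation r f) {x₀ : ℂ}
    (hx₀ : x₀ ∈ disc r) (hx₀' : x₀ ≠ 0) : ∃ φ, IsNormalizedHolonomy (foliationForm lam f) x₀ φ := by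
  obtain ⟨E⟩ := exists_logFirstIntegral lam hf hx₀ hx₀'
  obtain ⟨h1, h2⟩ := E.isMinimalFirstIntegral hf hx₀ hx₀'
  exact ⟨_, E.germ 0, h1, h2, E.isMonodromy hf hx₀ hx₀'⟩

/-! ### The correspondence between foliations and holonomies -/

/-- A conjugacy of the holonomies yields a conjugacy of the foliations. If some resonance
`k + (n - 1) lam = 0` occurs, the given conjugacy is extended; otherwise the foliations are
conjugate whatever their holonomies. -/
theorem foliationConjugacy_or_of_conjugacy {lam : ℂ} {r : ℝ} {f₁ f₂ : ℂ × ℂ → ℂ}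
    (hf₁ : IsPerturbation r f₁) (hf₂ : IsPerturbation r f₂) {x₀ : ℂ} (hx₀ : x₀ ∈ disc r)
    (hx₀' : x₀ ≠ 0)
    {φ₁ φ₂ : ℂ → ℂ} (hφ₁ : IsDiffGerm φ₁) (hφ₂ : IsDiffGerm φ₂) {h₁ h₂ : ℝ → ℂ⟦X⟧}
    (hh₁ : IsFormalFirstIntegral lam f₁ x₀ h₁)
    (hh₂ : IsFormalFirstIntegral lam f₂ x₀ h₂) (hl₂ : coeff 1 (h₂ 0) ≠ 0)
    (hm₁ : h₁ 1 = formalComp (taylorAtZero φ₁) (h₁ 0))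
    (hm₂ : h₂ 1 = formalComp (taylorAtZero φ₂) (h₂ 0))
    {c : ℂ} {ψ : ℂ⟦X⟧} (hψ : IsFormalConjugacy c ψ φ₁ φ₂) :
    FormalFoliationConjugacy (disc r) 1 (foliationForm lam f₁) (foliationForm lam f₂) ∨
    FormalFoliationConjugacy (disc r) (coeff 1 (h₁ 0) * c / coeff 1 (h₂ 0))
      (foliationForm lam f₁) (foliationForm lam f₂) := by
  by_cases hlam : ∀ n : ℕ, 2 ≤ n → ∀ k : ℕ, (k : ℂ) + ((n : ℂ) - 1) * lam ≠ 0
  · exact Or.inl (foliationConjugacy_of_not_resonant hf₁ hf₂ hlam)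
  · push Not at hlam
    obtain ⟨n, hn, k, hk⟩ := hlam
    exact Or.inr (foliationConjugacy_of_conjugacy hf₁ hf₂ hx₀ hx₀'
      (fun j m hm => mul_ne_natCast_of_resonant hn hk j hm) hφ₁ hφ₂ hh₁ hh₂ hl₂ hm₁ hm₂ hψ)

theorem corollary2p3 (lam : ℂ) (r : ℝ) (f₁ f₂ : ℂ × ℂ → ℂ)
    (hf₁ : IsPerturbation r f₁) (hf₂ : IsPerturbation r f₂)
    (x₀ : ℂ) (hx₀ : x₀ ∈ disc r) (hx₀' : x₀ ≠ 0) :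
    -- the holonomies exist, with normalized representatives
    (∃ φ₁, IsNormalizedHolonomy (foliationForm lam f₁) x₀ φ₁) ∧
    (∃ φ₂, IsNormalizedHolonomy (foliationForm lam f₂) x₀ φ₂) ∧
    -- conjugacies `(x, y + o(y))`
    (∀ φ₁ φ₂, IsNormalizedHolonomy (foliationForm lam f₁) x₀ φ₁ →
      IsNormalizedHolonomy (foliationForm lam f₂) x₀ φ₂ →
      (FormalFoliationConjugacy (disc r) 1 (foliationForm lam f₁) (foliationForm lam f₂) ↔
        TangentFormallyConjugate φ₁ φ₂)) ∧
    -- conjugacies `(x, c y + o(y))` with an arbitrary constant `c ≠ 0`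
    (∀ φ₁ φ₂, IsHolonomy (foliationForm lam f₁) x₀ φ₁ →
      IsHolonomy (foliationForm lam f₂) x₀ φ₂ →
      ((∃ c : ℂ, c ≠ 0 ∧
          FormalFoliationConjugacy (disc r) c (foliationForm lam f₁) (foliationForm lam f₂)) ↔
        FormallyConjugate φ₁ φ₂)) := by
  refine ⟨exists_normalizedHolonomy lam hf₁ hx₀ hx₀', exists_normalizedHolonomy lam hf₂ hx₀ hx₀',
    ?_, ?_⟩
  · rintro φ₁ φ₂ ⟨H₁, hH₁, hn₁, hM₁⟩ ⟨H₂, hH₂, hn₂, hM₂⟩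
    obtain ⟨h₁, hh₁, hc₁, hl₁, hm₁⟩ := exists_formalFirstIntegral hf₁ hx₀ hH₁ hM₁
    obtain ⟨h₂, hh₂, hc₂, hl₂, hm₂⟩ := exists_formalFirstIntegral hf₂ hx₀ hH₂ hM₂
    rw [hn₁] at hc₁
    rw [hn₂] at hc₂
    constructor
    · intro h
      obtain ⟨ψ, hψ⟩ :=
        conjugacy_of_foliationConjugacy hf₁ hf₂ hx₀ hx₀' h hM₁.1 hh₁ hh₂ hl₁ hm₁ hm₂
      rw [hc₁, hc₂, mul_one, div_one] at hψ
      exact ⟨ψ, hψ⟩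
    · rintro ⟨ψ, hψ⟩
      have h := foliationConjugacy_or_of_conjugacy hf₁ hf₂ hx₀ hx₀' hM₁.1 hM₂.1 hh₁ hh₂ hl₂ hm₁ hm₂ hψ
      rwa [hc₁, hc₂, mul_one, div_one, or_self] at h
  · rintro φ₁ φ₂ ⟨H₁, hH₁, hM₁⟩ ⟨H₂, hH₂, hM₂⟩
    obtain ⟨h₁, hh₁, -, hl₁, hm₁⟩ := exists_formalFirstIntegral hf₁ hx₀ hH₁ hM₁
    obtain ⟨h₂, hh₂, -, hl₂, hm₂⟩ := exists_formalFirstIntegral hf₂ hx₀ hH₂ hM₂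
    constructor
    · rintro ⟨c, hc, h⟩
      obtain ⟨ψ, hψ⟩ :=
        conjugacy_of_foliationConjugacy hf₁ hf₂ hx₀ hx₀' h hM₁.1 hh₁ hh₂ hl₁ hm₁ hm₂
      exact ⟨_, div_ne_zero (mul_ne_zero hl₂ hc) hl₁, ψ, hψ⟩
    · rintro ⟨c, hc, ψ, hψ⟩
      rcases foliationConjugacy_or_of_conjugacy hf₁ hf₂ hx₀ hx₀' hM₁.1 hM₂.1 hh₁ hh₂ hl₂ hm₁ hm₂ hψ
        with h | h
      · exact ⟨1, one_ne_zero, h⟩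
      · exact ⟨_, div_ne_zero (mul_ne_zero hl₁ hc) hl₂, h⟩
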